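/- Let $n\ge 2$, $a_0,\dots,a_{n-1}\in\mathbb C$, $a_n:=1$, $r_n:=0$, and let $r_0,\dots,r_{n-1}:\mathbb R\to\mathbb C$ be almost periodic, i.e. continuous and such that every sequence of reals $(b_k)$ has a subsequence $(\tilde b_m)$ along which $r_i(\cdot+\tilde b_m)$ converges uniformly on $\mathbb R$. Write $\mathcal{AP}$ for the set of almost periodic functions and $\mathcal{AP}^{n-2}$ for the set of functions $z$ with $z^{(i)}\in\mathcal{AP}$ for $0\le i\le n-2$. Consider $$y^{(n)}(t)+\sum_{i=0}^{n-1}(a_i+r_i(t))\,y^{(i)}(t)=0,\qquad t\in\mathbb R. \tag{1}$$ Put $P(a;x)=\sum_{i=0}^{n}a_ix^i$ and $P(r;x)=\sum_{i=0}^{n-1}r_ix^i$, let $\lambda$ be a root of $P(a;x)$, and set $$\mathcal Dz=\sum_{j=1}^{n}\frac1{j!}\,\partial_x^jP(a;\lambda)\,z^{(j-1)},\qquad \mathcal L(t,z)=\sum_{k=1}^{n-1}\frac1{k!}\,\partial_x^kP(r(t);\lambda)\,z^{(k-1)}(t),$$ $$\mathcal F(t,Z)=\sum_{i=2}^{n}\sum_{j=0}^{n-i}\binom{i+j}{j}(a_{i+j}+r_{i+j}(t))\lambda^j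 f_{i-1}(z,z',\dots,z^{(i-2)}),\qquad Z=(z,z',\dots,z^{(n-2)}),$$ where $f_i(x_1,\dots,x_i)=B_{i+1}(x_1,\dots,x_{i+1})-x_{i+1}$ and the complete Bell polynomials are given by $B_0=1$, $B_{i+1}=\sum_{j=0}^{i}\binom ij B_{i-j}x_{j+1}$. Assume that the characteristic polynomial $\sum_{j=1}^{n}\frac1{j!}\partial_x^jP(a;\lambda)x^{j-1}$ of $\mathcal D$, whose roots are the differences $\mu-\lambda$ with $\mu$ running over the other roots of $P(a;x)$, has $n-1$ pairwise different roots $\gamma_1,\dots,\gamma_{n-1}$ with $\alpha_j:=\Re\gamma_j\neq0$ (this holds in particular if all roots of $P(a;x)$ have distinct real parts). Put $\Gamma_j=\prod_{k\ne j}(\gamma_j-\gamma_k)$ and $\tilde\alpha_j=\sum_{i=0}^{n-2}|\gamma_j|^i$. For $\Re\omega\ne0$ let $g_\omega(t,s)=-\operatorname{sgn}(\Re\omega)e^{\omega(t-s)}$ if $\operatorname{sgn}(\Re\omega)(t-s)<0$ and $g_\omega(t,s)=0$ otherwise, and $$G_\omega[f](t)=\int_{\mathbb R}g_\omega(t,s)f(s)\,ds,\qquad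 I_\omega[f](t)=\int_{\mathbb R}|g_\omega(t,s)f(s)|\,ds,\qquad G=\sum_{j=1}^{n-1}\frac1{\Gamma_j}G_{\gamma_j}.$$ With $\|X\|=\sum_k|x_k|$ let $m(\delta)=\max_{1\le i\le n-1}m_i(\delta)$, where $m_i(\delta)$ is the supremum of $|f_i(X)-f_i(Y)|/\|X-Y\|$ over $X\ne Y$ in $\mathbb C^i$ with $\|X\|,\|Y\|<\delta$. For $0\le\beta<\min_j|\alpha_j|$ let $$L_\beta=\sum_{j=1}^{n-1}\sum_{k=1}^{n-1}\Big|\frac{\tilde\alpha_j}{\Gamma_j\,k!}\Big|\,\big\|I_{\alpha_j-\operatorname{sgn}(\alpha_j)\beta}[\partial_x^kP(r;\lambda)]\big\|_\infty,$$ $$Q_\beta=\sum_{j=1}^{n-1}\sum_{i=2}^{n}\sum_{k=0}^{i-2}\frac{\tilde\alpha_j}{|\Gamma_j|}\binom ik|\lambda|^k\Big(\frac{|a_i|}{|\alpha_j-\operatorname{sgn}(\alpha_j)\beta|}+\big\|I_{\alpha_j-\operatorname{sgn}(\alpha_j)\beta}[|r_i|]\big\|_\infty\Big),$$ and $H=\big\|\sum_{i=0}^{n-2}|G[P(r;\lambda)]^{(i)}|\big\|_\infty$.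 Assume $$L_0<1\qquad\text{and}\qquad H\le\max\{[1-L_0-m(\delta)Q_0]\,\delta\;:\;\delta\in(0,\delta_\lambda)\},$$ where $\delta_\lambda>0$ satisfies $0<m(\delta)<(1-L_0)/Q_0$ for all $\delta\in(0,\delta_\lambda)$ and $m(\delta_\lambda)=(1-L_0)/Q_0$. Then there are a solution $y_\lambda$ of (1) on $\mathbb R$ and a function $z\in\mathcal{AP}^{n-2}$ of class $C^{n-1}$ such that $z=y_\lambda'/y_\lambda-\lambda$, $$\mathcal Dz+P(r;\lambda)+\mathcal L(t,z)+\mathcal F(t,Z)=0,\qquad z=-G[P(r;\lambda)+\mathcal L(\cdot,z)+\mathcal F(\cdot,Z)],$$ and for all $t\in\mathbb R$ $$y_\lambda(t)=e^{\lambda t}\exp\Big((-1)^n\prod_{j=1}^{n-1}\gamma_j^{-1}\int_0^t\big[P(r;\lambda)+\mathcal L(\cdot,z)+\mathcal F(\cdot,Z)\big](s)\,ds\Big)\exp\Big(-\sum_{j=1}^{n-1}\frac1{\Gamma_j\gamma_j}G_{\gamma_j}\big[P(r;\lambda)+\mathcal L(\cdot,z)+\mathcal F(\cdot,Z)\big](t)\Big).$$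 Moreover, for every $0<\beta<\min_j|\alpha_j|$ with $L_\beta<\tfrac12$, with $O$ uniform in $t\in\mathbb R$, $$z^{(i)}=O\big((I_\beta+I_{-\beta})[P(r;\lambda)]\big)\quad(0\le i\le n-2),\qquad \frac{y_\lambda^{(i)}}{y_\lambda}=\lambda^i+O\big((I_\beta+I_{-\beta})[P(r;\lambda)]\big)\quad(0\le i\le n-1).$$ -/

import Mathlib

namespace PoincarePerron

noncomputable section

/-! Almost periodic functions. -/

/-- Almost periodic functions in the sense of Bochner: continuous, and every sequence of
translates has a subsequence converging uniformly on the real line. -/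
def IsAP (f : ℝ → ℂ) : Prop :=
  Continuous f ∧ ∀ b : ℕ → ℝ, ∃ φ : ℕ → ℕ, StrictMono φ ∧ ∃ g : ℝ → ℂ,
    TendstoUniformly (fun (m : ℕ) (t : ℝ) => f (t + b (φ m))) g Filter.atTop

/-- The functions whose derivatives of order `0, …, k` exist and are almost periodic. -/
def IsAPUpTo (k : ℕ) (z : ℝ → ℂ) : Prop :=
  ContDiff ℝ k z ∧ ∀ i ≤ k, IsAP (iteratedDeriv i z)

/-! Scalar Green kernels and operators. -/

/-- The kernel `g_ω(t, s)`. -/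
def greenKernel (ω : ℂ) (t s : ℝ) : ℂ :=
  if Real.sign ω.re * (t - s) < 0 then
    -(Real.sign ω.re : ℂ) * Complex.exp (ω * ((t - s : ℝ) : ℂ))
  else 0

/-- The operator `G_ω[f](t) = ∫ g_ω(t, s) f(s) ds`. -/
def opG (ω : ℂ) (f : ℝ → ℂ) (t : ℝ) : ℂ := ∫ s : ℝ, greenKernel ω t s * f s

/-- The operator `I_ω[f](t) = ∫ |g_ω(t, s) f(s)| ds`. -/
def opI (ω : ℂ) (f : ℝ → ℂ) (t : ℝ) : ℝ := ∫ s : ℝ, ‖greenKernel ω t s * f s‖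

/-- The sup norm over the real line (applied below only to bounded functions). -/
def supNorm (u : ℝ → ℝ) : ℝ := ⨆ t : ℝ, |u t|

/-- `Γ_j = ∏_{k ≠ j} (γ_j - γ_k)`. -/
def capGamma {N : ℕ} (γ : Fin N → ℂ) (j : Fin N) : ℂ :=
  ∏ k ∈ Finset.univ.erase j, (γ j - γ k)

/-- The Green operator `G[f] = ∑_j Γ_j⁻¹ G_{γ_j}[f]`. -/
def green {N : ℕ} (γ : Fin N → ℂ) (f : ℝ → ℂ) (t : ℝ) : ℂ :=
  ∑ j, 1 / capGamma γ j * opG (γ j) f t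

/-! Complete Bell polynomials. A sequence `x : ℕ → ℂ` lists the variables, `x k` being the
variable usually called `x_{k+1}`. -/

/-- The complete Bell polynomials, `B_0 = 1`,
`B_{i+1} = ∑_{j=0}^{i} (i choose j) B_{i-j} x_{j+1}`. -/
def bell (x : ℕ → ℂ) : ℕ → ℂ
  | 0 => 1
  | i + 1 => ∑ j : Fin (i + 1), (i.choose j : ℂ) * bell x (i - j) * x j

/-- The nonlinear part `f_i = B_{i+1} - x_{i+1}`, written as
`∑_{j=0}^{i-1} (i choose j) B_{i-j} x_{j+1}`; it depends on `x_1, …, x_i` only. -/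
def bellRem (i : ℕ) (x : ℕ → ℂ) : ℂ :=
  ∑ j ∈ Finset.range i, (i.choose j : ℂ) * bell x (i - j) * x j

theorem bellRem_eq (i : ℕ) (x : ℕ → ℂ) : bellRem i x = bell x (i + 1) - x i := by
  rw [bell, Fin.sum_univ_eq_sum_range (fun j => (i.choose j : ℂ) * bell x (i - j) * x j),
    Finset.sum_range_succ]
  simp [bellRem, bell]

/-- Extension of a finite tuple by zero. -/
def extend {i : ℕ} (X : Fin i → ℂ) (k : ℕ) : ℂ := if h : k < i then X ⟨k, h⟩ else 0

/-- The norm `‖X‖ = ∑ |x_k|` on tuples. -/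
def norm1 {i : ℕ} (X : Fin i → ℂ) : ℝ := ∑ k, ‖X k‖

/-- The best Lipschitz constant `m_i(δ)` of `f_i` on the ball `B(0; δ)`. -/
def lipConst (i : ℕ) (δ : ℝ) : ℝ :=
  sSup {ρ : ℝ | ∃ X Y : Fin i → ℂ, X ≠ Y ∧ norm1 X < δ ∧ norm1 Y < δ ∧
    ρ = ‖bellRem i (extend X) - bellRem i (extend Y)‖ / norm1 (X - Y)}

/-- `m(δ)`, the maximum of `m_1(δ), …, m_{n-1}(δ)`. -/
def lipMax (n : ℕ) (δ : ℝ) : ℝ := ⨆ i : Fin (n - 1), lipConst (i + 1) δ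

/-! The equation `y^(n) + ∑_{i<n} (a_i + r_i(t)) y^(i) = 0`. -/

section Equation

variable {n : ℕ}

/-- The coefficients `a_0, …, a_{n-1}`, completed by `a_n = 1`. -/
def coeffA (a : Fin n → ℂ) (i : ℕ) : ℂ :=
  if h : i < n then a ⟨i, h⟩ else if i = n then 1 else 0

/-- The perturbations `r_0, …, r_{n-1}`, completed by `r_n = 0`. -/
def coeffR (r : Fin n → ℝ → ℂ) (i : ℕ) (t : ℝ) : ℂ :=
  if h : i < n then r ⟨i, h⟩ t else 0

/-- `y` is an `n` times continuously differentiable solution on the whole real line. -/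
def IsSolution (a : Fin n → ℂ) (r : Fin n → ℝ → ℂ) (y : ℝ → ℂ) : Prop :=
  ContDiff ℝ n y ∧
    ∀ t, iteratedDeriv n y t + ∑ i : Fin n, (a i + r i t) * iteratedDeriv i y t = 0

/-- The characteristic polynomial `P(a; x) = x^n + ∑_{i<n} a_i x^i`. -/
def polyA (a : Fin n → ℂ) : Polynomial ℂ :=
  Polynomial.X ^ n + ∑ i : Fin n, Polynomial.C (a i) * Polynomial.X ^ (i : ℕ)

/-- The polynomial `P(r(t); x) = ∑_{i<n} r_i(t) x^i`. -/
def polyR (r : Fin n → ℝ → ℂ) (t : ℝ) : Polynomial ℂ :=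
  ∑ i : Fin n, Polynomial.C (r i t) * Polynomial.X ^ (i : ℕ)

/-- The partial derivative `∂^k P(r(t); x) / ∂x^k` at `x = lam`. -/
def derivPR (r : Fin n → ℝ → ℂ) (lam : ℂ) (k : ℕ) (t : ℝ) : ℂ :=
  (Polynomial.derivative^[k] (polyR r t)).eval lam

/-- `P(r(t); lam)`. -/
def evalPR (r : Fin n → ℝ → ℂ) (lam : ℂ) (t : ℝ) : ℂ := (polyR r t).eval lam

/-- The coefficient `(1/j!) ∂^j P(a; x) / ∂x^j` at `x = lam` of the operator `𝒟`. -/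
def coeffD (a : Fin n → ℂ) (lam : ℂ) (j : ℕ) : ℂ :=
  1 / (j.factorial : ℂ) * (Polynomial.derivative^[j] (polyA a)).eval lam

/-- The operator `𝒟 z = ∑_{j=1}^{n} (1/j!) ∂^j P(a; lam) z^(j-1)`. -/
def opD (a : Fin n → ℂ) (lam : ℂ) (z : ℝ → ℂ) (t : ℝ) : ℂ :=
  ∑ j ∈ Finset.Icc 1 n, coeffD a lam j * iteratedDeriv (j - 1) z t

/-- The characteristic polynomial of `𝒟`. -/
def polyD (a : Fin n → ℂ) (lam : ℂ) : Polynomial ℂ :=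
  ∑ j ∈ Finset.Icc 1 n, Polynomial.C (coeffD a lam j) * Polynomial.X ^ (j - 1)

/-- The linear term `ℒ(t, z) = ∑_{k=1}^{n-1} (1/k!) ∂^k P(r(t); lam) z^(k-1)(t)`. -/
def termL (r : Fin n → ℝ → ℂ) (lam : ℂ) (z : ℝ → ℂ) (t : ℝ) : ℂ :=
  ∑ k ∈ Finset.Icc 1 (n - 1),
    1 / (k.factorial : ℂ) * derivPR r lam k t * iteratedDeriv (k - 1) z t

/-- The nonlinear term `ℱ(t, z, …, z^(n-2))`, equal to
`∑_{i=2}^{n} ∑_{j=0}^{n-i} (i+j choose j) (a_{i+j} + r_{i+j}(t)) lam^j f_{i-1}(z, …, z^(i-2))`. -/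
def termF (a : Fin n → ℂ) (r : Fin n → ℝ → ℂ) (lam : ℂ) (z : ℝ → ℂ) (t : ℝ) : ℂ :=
  ∑ i ∈ Finset.Icc 2 n, ∑ j ∈ Finset.range (n - i + 1),
    ((i + j).choose j : ℂ) * (coeffA a (i + j) + coeffR r (i + j) t) * lam ^ j *
      bellRem (i - 1) (fun k => iteratedDeriv k z t)

/-- The function `P(r; lam) + ℒ(·, z) + ℱ(·, z, …, z^(n-2))`. -/
def rhs (a : Fin n → ℂ) (r : Fin n → ℝ → ℂ) (lam : ℂ) (z : ℝ → ℂ) (t : ℝ) : ℂ :=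
  evalPR r lam t + termL r lam z t + termF a r lam z t

/-- `α̃_j = ∑_{i=0}^{n-2} |γ_j|^i`. -/
def alphaTilde (γ : Fin (n - 1) → ℂ) (j : Fin (n - 1)) : ℝ :=
  ∑ i ∈ Finset.range (n - 1), ‖γ j‖ ^ i

/-- `α - sgn(α) β` with `α = Re γ_j`. -/
def shift (γ : Fin (n - 1) → ℂ) (β : ℝ) (j : Fin (n - 1)) : ℝ :=
  (γ j).re - Real.sign (γ j).re * β

/-- The constant `L_β`. -/
def constL (r : Fin n → ℝ → ℂ) (lam : ℂ) (γ : Fin (n - 1) → ℂ) (β : ℝ) : ℝ :=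
  ∑ j : Fin (n - 1), ∑ k ∈ Finset.Icc 1 (n - 1),
    ‖(alphaTilde γ j : ℂ) / (capGamma γ j * (k.factorial : ℂ))‖ *
      supNorm (opI (shift γ β j : ℂ) (derivPR r lam k))

/-- The constant `Q_β`. -/
def constQ (a : Fin n → ℂ) (r : Fin n → ℝ → ℂ) (lam : ℂ) (γ : Fin (n - 1) → ℂ) (β : ℝ) : ℝ :=
  ∑ j : Fin (n - 1), ∑ i ∈ Finset.Icc 2 n, ∑ k ∈ Finset.range (i - 1),
    alphaTilde γ j / ‖capGamma γ j‖ * (i.choose k : ℝ) * ‖lam‖ ^ k *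
      (‖coeffA a i‖ / |shift γ β j| +
        supNorm (opI (shift γ β j : ℂ) (fun t => (‖coeffR r i t‖ : ℂ))))

/-- The constant `H`, the sup norm of `∑_{i=0}^{n-2} |G[P(r; lam)]^(i)|`. -/
def constH (r : Fin n → ℝ → ℂ) (lam : ℂ) (γ : Fin (n - 1) → ℂ) : ℝ :=
  supNorm (fun t => ∑ i ∈ Finset.range (n - 1),
    ‖iteratedDeriv i (green γ (evalPR r lam)) t‖)

/-- The comparison function `(I_β + I_{-β})[P(r; lam)]`. -/
def gauge (r : Fin n → ℝ → ℂ) (lam : ℂ) (β : ℝ) (t : ℝ) : ℝ :=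
  opI (β : ℂ) (evalPR r lam) t + opI ((-β : ℝ) : ℂ) (evalPR r lam) t

end Equation

end

end PoincarePerron

/-! Write `y = exp ∫ (λ + z)`. By Leibniz' rule each `y^(i) / y` is a binomial sum of complete Bell
polynomials in `z, z', …` (`iteratedDeriv_eq_quot_mul`). Expanding `P(a; x) + P(r; x)` at the root
`λ` and splitting `B_m = x_m + f_{m-1}` therefore turns the linear equation into `𝒟z + P(r; λ) + ℒ +
ℱ = 0` (`sum_coeff_mul_quot`). No characteristic root `γ_j` of `𝒟` is purely imaginary, so `𝒟` has
the bounded inverse `G` on bounded continuous functions, and the task is to solve `z = -G[P(r; λ) +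
ℒ + ℱ]`.

This is a fixed point problem for the jet `(z, …, z^(n-2))` in the sup norm built on `‖·‖₁`
(`exists_jet`). On the ball of radius `δ` the map has Lipschitz constant `κ = L_0 + m(δ) Q_0`
(`sum_norm_greenJet_sub_le`), and it sends `0` to a jet of norm at most `H`. Hence it is a
contraction of the ball into itself if `κ < 1` and `H ≤ (1 - κ) δ`. Such a `δ` exists because the
maximum in the hypothesis is attained (`exists_radius`).

Almost periodicity comes from the choice of the complete space: jets whose translates are controlled
by the translates of the `r_i` (`IsSubord`). This property survives sums, products, `G_ω` and
uniform limits, and it implies almost periodicity (`IsSubord.isAP`).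

For the asymptotics, an almost periodic `P(r; λ)` either vanishes identically, and then the fixed
point is `0`, or `(I_β + I_{-β})[P(r; λ)]` is bounded below by a positive constant
(`IsAP.exists_pos_le_opI`). In both cases boundedness yields the `O` estimates (`isBigO_gauge`). -/

namespace PoincarePerron

noncomputable section

/-! ### Bell polynomials, their Lipschitz constants and the choice of the radius. -/

theorem bell_succ (x : ℕ → ℂ) (k : ℕ) :
    bell x (k + 1) = ∑ j ∈ Finset.range (k + 1), (k.choose j : ℂ) * bell x (k - j) * x j := by
  rw [bell, Fin.sum_univ_eq_sum_range (fun j => (k.choose j : ℂ) * bell x (k - j) * x j)]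

theorem bell_congr {x y : ℕ → ℂ} (k : ℕ) (h : ∀ j < k, x j = y j) : bell x k = bell y k := by
  induction k using Nat.strong_induction_on with
  | _ k ih =>
    rcases k with _ | k
    · simp [bell]
    · rw [bell_succ, bell_succ]
      refine Finset.sum_congr rfl fun j hj => ?_
      have hj' := Finset.mem_range.1 hj
      rw [ih (k - j) (by omega) fun i hi => h i (by omega), h j hj']

theorem bellRem_congr {x y : ℕ → ℂ} (i : ℕ) (h : ∀ j < i, x j = y j) :
    bellRem i x = bellRem i y := by
  refine Finset.sum_congr rfl fun j hj => ?_
  have hj' := Finset.mem_range.1 hj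
  rw [bell_congr (i - j) fun k hk => h k (by omega), h j hj']

theorem bellRem_zero (i : ℕ) : bellRem i (fun _ => 0) = 0 := by simp [bellRem]

/-- On bounded sets the complete Bell polynomials are bounded and Lipschitz continuous. -/
theorem exists_bell_bound {R : ℝ} (hR : 0 ≤ R) (k : ℕ) :
    ∃ C : ℝ, 0 ≤ C ∧ ∀ (x y : ℕ → ℂ) (d : ℝ), 0 ≤ d → (∀ j < k, ‖x j‖ ≤ R) →
      (∀ j < k, ‖y j‖ ≤ R) → (∀ j < k, ‖x j - y j‖ ≤ d) →
      ‖bell x k‖ ≤ C ∧ ‖bell x k - bell y k‖ ≤ C * d := by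
  induction k using Nat.strong_induction_on with
  | _ k ih =>
    rcases k with _ | k
    · exact ⟨1, zero_le_one, fun x y d hd _ _ _ => by simp [bell, hd]⟩
    · choose! C hC0 hC using ih
      -- In the factor `R + 1`, `R` bounds `x j` and `1` accounts for the increment `x j - y j`, so
      -- one constant serves both claims.
      refine ⟨∑ j ∈ Finset.range (k + 1), (k.choose j : ℝ) * C (k - j) * (R + 1),
        Finset.sum_nonneg fun j hj => ?_, fun x y d hd hx hy hxy => ⟨?_, ?_⟩⟩
      · have := hC0 (k - j) (by omega)
        positivity
      · rw [bell_succ]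
        refine (norm_sum_le _ _).trans (Finset.sum_le_sum fun j hj => ?_)
        have hj' := Finset.mem_range.1 hj
        have h0 := hC0 (k - j) (by omega)
        have h1 := (hC (k - j) (by omega) x x 0 le_rfl (fun i hi => hx i (by omega))
          (fun i hi => hx i (by omega)) (by simp)).1
        rw [norm_mul, norm_mul, Complex.norm_natCast]
        have h2 := (hx j hj').trans (by linarith : R ≤ R + 1)
        gcongr
      · rw [bell_succ, bell_succ, ← Finset.sum_sub_distrib, Finset.sum_mul]
        refine (norm_sum_le _ _).trans (Finset.sum_le_sum fun j hj => ?_)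
        have hj' := Finset.mem_range.1 hj
        have h0 := hC0 (k - j) (by omega)
        -- With `x` and `y` exchanged, the first component bounds `bell y`, as the product splitting
        -- below requires.
        have h1 := hC (k - j) (by omega) y x d hd (fun i hi => hy i (by omega))
          (fun i hi => hx i (by omega))
          (fun i hi => by rw [norm_sub_rev]; exact hxy i (by omega))
        have e : (k.choose j : ℂ) * bell x (k - j) * x j - k.choose j * bell y (k - j) * y j
            = k.choose j * ((bell x (k - j) - bell y (k - j)) * x j
              + bell y (k - j) * (x j - y j)) := by ring
        rw [e, norm_mul, Complex.norm_natCast]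
        have h3 : ‖(bell x (k - j) - bell y (k - j)) * x j + bell y (k - j) * (x j - y j)‖
            ≤ C (k - j) * d * R + C (k - j) * d := by
          refine (norm_add_le _ _).trans ?_
          rw [norm_mul, norm_mul]
          have := h1.2
          rw [norm_sub_rev] at this
          exact add_le_add (mul_le_mul this (hx j hj') (norm_nonneg _) (by positivity))
            (mul_le_mul h1.1 (hxy j hj') (norm_nonneg _) h0)
        calc (k.choose j : ℝ) * _ ≤ k.choose j * (C (k - j) * d * R + C (k - j) * d) := by gcongr
          _ = _ := by ring

theorem norm_le_norm1 {i : ℕ} (X : Fin i → ℂ) (k : Fin i) : ‖X k‖ ≤ norm1 X :=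
  Finset.single_le_sum (f := fun k => ‖X k‖) (fun _ _ => norm_nonneg _) (Finset.mem_univ k)

theorem norm1_nonneg {i : ℕ} (X : Fin i → ℂ) : 0 ≤ norm1 X :=
  Finset.sum_nonneg fun _ _ => norm_nonneg _

theorem norm1_pos {i : ℕ} {X Y : Fin i → ℂ} (h : X ≠ Y) : 0 < norm1 (X - Y) := by
  obtain ⟨k, hk⟩ := Function.ne_iff.1 h
  exact (norm_pos_iff.2 (sub_ne_zero.2 hk)).trans_le (norm_le_norm1 (X - Y) k)

theorem extend_apply {i : ℕ} (X : Fin i → ℂ) {k : ℕ} (h : k < i) : extend X k = X ⟨k, h⟩ := by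
  simp [extend, h]

theorem norm_extend_le {i : ℕ} (X : Fin i → ℂ) (k : ℕ) : ‖extend X k‖ ≤ norm1 X := by
  unfold extend
  split
  · exact norm_le_norm1 _ _
  · simpa using norm1_nonneg X

theorem extend_sub {i : ℕ} (X Y : Fin i → ℂ) (k : ℕ) :
    extend X k - extend Y k = extend (X - Y) k := by
  unfold extend
  split <;> simp

theorem bddAbove_lipConst (i : ℕ) (δ : ℝ) :
    BddAbove {ρ : ℝ | ∃ X Y : Fin i → ℂ, X ≠ Y ∧ norm1 X < δ ∧ norm1 Y < δ ∧
      ρ = ‖bellRem i (extend X) - bellRem i (extend Y)‖ / norm1 (X - Y)} := by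
  obtain ⟨C, hC0, hC⟩ := exists_bell_bound (abs_nonneg δ) (i + 1)
  -- The extra `1` pays for the variable subtracted in `f_i = B_{i+1} - x_{i+1}`.
  refine ⟨C + 1, ?_⟩
  rintro _ ⟨X, Y, hne, hX, hY, rfl⟩
  rw [div_le_iff₀ (norm1_pos hne), bellRem_eq, bellRem_eq]
  have h := (hC (extend X) (extend Y) (norm1 (X - Y)) (norm1_nonneg _)
    (fun j _ => (norm_extend_le X j).trans (hX.le.trans (le_abs_self _)))
    (fun j _ => (norm_extend_le Y j).trans (hY.le.trans (le_abs_self _)))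
    (fun j _ => by rw [extend_sub]; exact norm_extend_le _ j)).2
  have h2 : ‖extend X i - extend Y i‖ ≤ norm1 (X - Y) := by
    rw [extend_sub]; exact norm_extend_le _ i
  calc _ = ‖(bell (extend X) (i + 1) - bell (extend Y) (i + 1))
        - (extend X i - extend Y i)‖ := by ring_nf
    _ ≤ _ := (norm_sub_le _ _).trans (by linarith)

theorem lipConst_nonneg (i : ℕ) (δ : ℝ) : 0 ≤ lipConst i δ := by
  refine Real.sSup_nonneg ?_
  rintro _ ⟨X, Y, -, -, -, rfl⟩
  exact div_nonneg (norm_nonneg _) (norm1_nonneg _)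

theorem lipConst_le_lipMax {n i : ℕ} (hi : i < n - 1) (δ : ℝ) :
    lipConst (i + 1) δ ≤ lipMax n δ :=
  le_ciSup (f := fun i : Fin (n - 1) => lipConst (i + 1) δ) (Set.finite_range _).bddAbove ⟨i, hi⟩

theorem lipMax_nonneg (n : ℕ) (δ : ℝ) : 0 ≤ lipMax n δ :=
  Real.iSup_nonneg fun _ => lipConst_nonneg _ _

theorem norm_bellRem_sub_le_of_lt {i : ℕ} {δ : ℝ} {X Y : Fin i → ℂ} (hX : norm1 X < δ)
    (hY : norm1 Y < δ) : ‖bellRem i (extend X) - bellRem i (extend Y)‖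
      ≤ lipConst i δ * norm1 (X - Y) := by
  rcases eq_or_ne X Y with rfl | hne
  · simp [norm1]
  · rw [← div_le_iff₀ (norm1_pos hne)]
    exact le_csSup (bddAbove_lipConst i δ) ⟨X, Y, hne, hX, hY, rfl⟩

theorem continuous_extend {i : ℕ} (k : ℕ) : Continuous fun X : Fin i → ℂ => extend X k := by
  unfold extend
  split
  · exact continuous_apply _
  · exact continuous_const

theorem continuous_bell {T : Type*} [TopologicalSpace T] {x : T → ℕ → ℂ} (k : ℕ)
    (h : ∀ j < k, Continuous fun t => x t j) : Continuous fun t => bell (x t) k := by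
  induction k using Nat.strong_induction_on with
  | _ k ih =>
    rcases k with _ | k
    · simpa [bell] using continuous_const
    · simp_rw [bell_succ]
      refine continuous_finsetSum _ fun j hj => ?_
      have hj' := Finset.mem_range.1 hj
      exact (continuous_const.mul (ih (k - j) (by omega) fun i hi => h i (by omega))).mul (h j hj')

theorem continuous_bellRem {T : Type*} [TopologicalSpace T] {x : T → ℕ → ℂ} (i : ℕ)
    (h : ∀ j < i, Continuous fun t => x t j) : Continuous fun t => bellRem i (x t) := by
  unfold bellRem
  refine continuous_finsetSum _ fun j hj => ?_
  have hj' := Finset.mem_range.1 hj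
  exact (continuous_const.mul (continuous_bell (i - j) fun k hk => h k (by omega))).mul (h j hj')

theorem norm1_smul {i : ℕ} {c : ℝ} (hc : 0 ≤ c) (X : Fin i → ℂ) :
    norm1 ((c : ℂ) • X) = c * norm1 X := by
  simp [norm1, Finset.mul_sum, abs_of_nonneg hc]

/-- The Lipschitz estimate on the open ball extends to the closed ball. -/
theorem norm_bellRem_sub_le {i : ℕ} {δ : ℝ} (hδ : 0 < δ) {X Y : Fin i → ℂ} (hX : norm1 X ≤ δ)
    (hY : norm1 Y ≤ δ) : ‖bellRem i (extend X) - bellRem i (extend Y)‖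
      ≤ lipConst i δ * norm1 (X - Y) := by
  -- For `0 < c < 1` the points `c X`, `c Y` lie in the open ball; then `c` tends to `1` from below.
  have hc : Continuous fun c : ℝ =>
      ‖bellRem i (extend ((c : ℂ) • X)) - bellRem i (extend ((c : ℂ) • Y))‖ := by
    have h (Z : Fin i → ℂ) : Continuous fun c : ℝ => bellRem i (extend ((c : ℂ) • Z)) :=
      continuous_bellRem i fun j _ => (continuous_extend j).comp
        (Complex.continuous_ofReal.smul continuous_const)
    exact ((h X).sub (h Y)).norm
  have hlim := (hc.tendsto 1).mono_left (nhdsWithin_le_nhds (s := Set.Iio 1))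
  simp only [Complex.ofReal_one, one_smul] at hlim
  refine le_of_tendsto hlim ?_
  filter_upwards [Ioo_mem_nhdsLT (zero_lt_one' ℝ)] with c hc
  have hb (Z : Fin i → ℂ) (hZ : norm1 Z ≤ δ) : norm1 ((c : ℂ) • Z) < δ := by
    rw [norm1_smul hc.1.le]
    nlinarith [hc.1, hc.2, norm1_nonneg Z]
  refine (norm_bellRem_sub_le_of_lt (hb X hX) (hb Y hY)).trans ?_
  rw [← smul_sub, norm1_smul hc.1.le]
  refine mul_le_mul_of_nonneg_left ?_ (lipConst_nonneg i δ)
  nlinarith [hc.1, hc.2, norm1_nonneg (X - Y)]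

/-- The Lipschitz estimate for `f_{i+1}` in terms of sequences. -/
theorem norm_bellRem_sub_le_lipMax {n i : ℕ} (hi : i < n - 1) {δ : ℝ} (hδ : 0 < δ) {x y : ℕ → ℂ}
    (hx : ∑ k ∈ Finset.range (n - 1), ‖x k‖ ≤ δ) (hy : ∑ k ∈ Finset.range (n - 1), ‖y k‖ ≤ δ) :
    ‖bellRem (i + 1) x - bellRem (i + 1) y‖
      ≤ lipMax n δ * ∑ k ∈ Finset.range (n - 1), ‖x k - y k‖ := by
  have hle (u : ℕ → ℂ) : norm1 (fun k : Fin (i + 1) => u k)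
      ≤ ∑ k ∈ Finset.range (n - 1), ‖u k‖ := by
    rw [norm1, Fin.sum_univ_eq_sum_range (fun k => ‖u k‖)]
    exact Finset.sum_le_sum_of_subset_of_nonneg
      (Finset.range_subset_range.2 (by omega)) fun _ _ _ => norm_nonneg _
  have hco (u : ℕ → ℂ) : bellRem (i + 1) u
      = bellRem (i + 1) (extend fun k : Fin (i + 1) => u k) :=
    bellRem_congr _ fun j hj => by rw [extend_apply _ hj]
  rw [hco x, hco y]
  refine (norm_bellRem_sub_le hδ ((hle x).trans hx) ((hle y).trans hy)).trans ?_
  exact mul_le_mul (lipConst_le_lipMax hi δ) (hle fun k => x k - y k) (norm1_nonneg _)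
    (lipMax_nonneg n δ)

/-- Lower semicontinuity of `m`: a pair in the open ball whose quotient exceeds `c` still lies in
every slightly smaller open ball. -/
theorem eventually_lt_lipMax {n : ℕ} (hn : 2 ≤ n) {δ c : ℝ} (h : c < lipMax n δ) :
    ∀ᶠ δ' in nhds δ, c < lipMax n δ' := by
  rcases lt_or_ge c 0 with hc | hc
  · exact Filter.Eventually.of_forall fun δ' => hc.trans_le (lipMax_nonneg n δ')
  · have : Nonempty (Fin (n - 1)) := ⟨⟨0, by omega⟩⟩
    obtain ⟨i, hi⟩ := exists_lt_of_lt_ciSup h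
    -- An empty set would have `sSup` equal to `0`, contradicting `0 ≤ c < lipConst`.
    have hne : {ρ : ℝ | ∃ X Y : Fin (i + 1 : ℕ) → ℂ, X ≠ Y ∧ norm1 X < δ ∧ norm1 Y < δ ∧
      ρ = ‖bellRem (i + 1) (extend X) - bellRem (i + 1) (extend Y)‖
        / norm1 (X - Y)}.Nonempty := by
      by_contra hne
      rw [Set.not_nonempty_iff_eq_empty] at hne
      rw [lipConst, hne, Real.sSup_empty] at hi
      exact absurd hc (not_le.2 hi)
    obtain ⟨_, ⟨X, Y, hXY, hX, hY, rfl⟩, hlt⟩ := exists_lt_of_lt_csSup hne hi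
    filter_upwards [lt_mem_nhds hX, lt_mem_nhds hY] with δ' h1 h2
    exact (hlt.trans_le (le_csSup (bddAbove_lipConst _ δ') ⟨X, Y, hXY, h1, h2, rfl⟩)).trans_le
      (lipConst_le_lipMax i.2 δ')

/-- The supremum of `(A - m(δ) Q) δ` over `(0, δl)` is attained. -/
theorem exists_radius {n : ℕ} (hn : 2 ≤ n) {A Q H δl : ℝ} (hQ : 0 ≤ Q) (hδl : 0 < δl)
    (hlt : ∀ δ ∈ Set.Ioo 0 δl, 0 < lipMax n δ ∧ lipMax n δ < A / Q)
    (heq : lipMax n δl = A / Q)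
    (hH : H ≤ sSup ((fun δ => (A - lipMax n δ * Q) * δ) '' Set.Ioo 0 δl)) :
    ∃ δ, 0 < δ ∧ lipMax n δ * Q < A ∧ H ≤ (A - lipMax n δ * Q) * δ := by
  set f : ℝ → ℝ := fun δ => (A - lipMax n δ * Q) * δ with hf
  have hmem : δl / 2 ∈ Set.Ioo 0 δl := ⟨by linarith, by linarith⟩
  -- For `Q = 0` the convention `A / 0 = 0` contradicts `0 < m(δ) < A / Q`.
  have hQ' : 0 < Q := by
    rcases hQ.eq_or_lt with h | h
    · have := hlt _ hmem
      rw [← h, div_zero] at this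
      linarith
    · exact h
  have hA (δ) (hδ : δ ∈ Set.Ioo 0 δl) : lipMax n δ * Q < A :=
    (lt_div_iff₀ hQ').1 (hlt δ hδ).2
  have husc : UpperSemicontinuousOn f (Set.Icc 0 δl) := by
    intro δ hδ y hy
    have hcont : ContinuousAt (fun c => (A - c * Q) * δ) (lipMax n δ) := by fun_prop
    have h1 : ∀ᶠ c in nhdsWithin (lipMax n δ) (Set.Iio (lipMax n δ)), (A - c * Q) * δ < y :=
      (hcont.eventually (gt_mem_nhds hy)).filter_mono nhdsWithin_le_nhds
    -- A level `c` just below `m(δ)` still gives a value below `y`; nearby `m(δ') > c`, and `Q, δ' ≥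
    -- 0` turn this into an upper bound for `f δ'`.
    obtain ⟨c, hc, hcm⟩ := (h1.and self_mem_nhdsWithin).exists
    have hcont' : ContinuousAt (fun δ => (A - c * Q) * δ) δ := by fun_prop
    filter_upwards [nhdsWithin_le_nhds (eventually_lt_lipMax hn hcm),
      nhdsWithin_le_nhds (hcont'.eventually (gt_mem_nhds hc)), self_mem_nhdsWithin]
      with δ' h2 h3 h4
    refine lt_of_le_of_lt ?_ h3
    exact mul_le_mul_of_nonneg_right (by nlinarith) h4.1
  -- The maximum over the closed interval is positive, while `f` vanishes at `0` and, because `m(δl)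
  -- = A / Q`, at `δl`; so it is attained inside.
  obtain ⟨δ, hδ, hmax⟩ := husc.exists_isMaxOn ⟨0, by simp [hδl.le]⟩ isCompact_Icc
  have hpos : 0 < f δ := by
    refine lt_of_lt_of_le ?_ (hmax (Set.Ioo_subset_Icc_self hmem))
    exact mul_pos (sub_pos.2 (hA _ hmem)) hmem.1
  have h0 : 0 < δ := by
    refine lt_of_le_of_ne hδ.1 ?_
    rintro rfl
    simp [hf] at hpos
  have h1 : δ < δl := by
    refine lt_of_le_of_ne hδ.2 ?_
    rintro rfl
    rw [hf] at hpos
    simp only [heq, div_mul_cancel₀ _ hQ'.ne', sub_self, zero_mul, lt_irrefl] at hpos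
  refine ⟨δ, h0, hA δ ⟨h0, h1⟩, hH.trans (csSup_le ⟨_, Set.mem_image_of_mem f hmem⟩ ?_)⟩
  rintro _ ⟨δ', hδ', rfl⟩
  exact hmax (Set.Ioo_subset_Icc_self hδ')

/-! Partial fractions for pairwise different nodes. -/

/-- The sum is the coefficient of `X^(N-1)` in the Lagrange interpolant of `X^i`, which is `X^i`
itself. It decides which derivatives of `G[f]` pick up a copy of `f`. -/
theorem sum_pow_div_capGamma {N : ℕ} (γ : Fin N → ℂ) (hγ : Function.Injective γ) {i : ℕ}
    (hi : i < N) : ∑ j, γ j ^ i / capGamma γ j = if i = N - 1 then 1 else 0 := by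
  have h := Lagrange.coeff_eq_sum (s := Finset.univ) (v := γ) (hγ.injOn)
    (P := Polynomial.X ^ i) (by rw [Polynomial.degree_X_pow]; simpa using hi)
  simp only [Polynomial.coeff_X_pow, Finset.card_univ, Fintype.card_fin, Polynomial.eval_pow,
    Polynomial.eval_X] at h
  rw [← show _ = ∑ j, γ j ^ i / capGamma γ j from h]
  exact if_congr eq_comm rfl rfl

/-- Lagrange interpolation of the constant `1`, evaluated at `0`. This is the factor of `∫ f` in the
formula for `y`. -/
theorem sum_one_div_capGamma_mul {N : ℕ} (hN : 0 < N) (γ : Fin N → ℂ)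
    (hγ : Function.Injective γ) (h0 : ∀ j, γ j ≠ 0) :
    ∑ j, 1 / (capGamma γ j * γ j) = (-1) ^ (N + 1) * ∏ j, (γ j)⁻¹ := by
  have hx : ∀ i ∈ Finset.univ, (0 : ℂ) ≠ γ i := fun i _ => (h0 i).symm
  have hne : (Finset.univ : Finset (Fin N)).Nonempty := ⟨⟨0, hN⟩, Finset.mem_univ _⟩
  have h := Lagrange.eval_interpolate_not_at_node (s := Finset.univ) (v := γ) 1 hx
  rw [Lagrange.interpolate_one hγ.injOn hne, Lagrange.eval_nodal] at h
  have e1 : ∏ i, (0 - γ i) = (-1) ^ N * ∏ i, γ i := by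
    simp [zero_sub, Finset.prod_neg]
  have e2 : ∑ i, Lagrange.nodalWeight Finset.univ γ i * (0 - γ i)⁻¹ * (1 : Fin N → ℂ) i
      = - ∑ j, 1 / (capGamma γ j * γ j) := by
    rw [← Finset.sum_neg_distrib]
    refine Finset.sum_congr rfl fun i _ => ?_
    rw [Lagrange.nodalWeight, Finset.prod_inv_distrib, capGamma, zero_sub, inv_neg, Pi.one_apply,
      one_div, mul_inv]
    ring
  rw [e1, e2, Polynomial.eval_one] at h
  have hp : ∏ i, γ i ≠ 0 := Finset.prod_ne_zero_iff.2 fun i _ => h0 i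
  rw [Finset.prod_inv_distrib]
  have h4 : ((-1 : ℂ) ^ N) * (-1) ^ N = 1 := by rw [← mul_pow]; simp
  field_simp
  rw [pow_succ]
  linear_combination ((-1) ^ N : ℂ) * h - (∏ i, γ i) * (∑ j, 1 / (capGamma γ j * γ j)) * h4

end

end PoincarePerron

namespace PoincarePerron

noncomputable section

open MeasureTheory

/-! The scalar Green operators on bounded continuous functions. -/

/-- Bounded continuous functions. -/
def IsBC (f : ℝ → ℂ) : Prop := Continuous f ∧ ∃ M, ∀ t, ‖f t‖ ≤ M

theorem IsBC.const (c : ℂ) : IsBC fun _ => c := ⟨continuous_const, ‖c‖, fun _ => le_rfl⟩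

theorem IsBC.add {f g : ℝ → ℂ} (hf : IsBC f) (hg : IsBC g) : IsBC fun t => f t + g t := by
  obtain ⟨hf, M, hM⟩ := hf
  obtain ⟨hg, M', hM'⟩ := hg
  exact ⟨hf.add hg, M + M', fun t => (norm_add_le _ _).trans (add_le_add (hM t) (hM' t))⟩

theorem IsBC.mul {f g : ℝ → ℂ} (hf : IsBC f) (hg : IsBC g) : IsBC fun t => f t * g t := by
  obtain ⟨hf, M, hM⟩ := hf
  obtain ⟨hg, M', hM'⟩ := hg
  refine ⟨hf.mul hg, M * M', fun t => ?_⟩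
  rw [norm_mul]
  exact mul_le_mul (hM t) (hM' t) (norm_nonneg _) ((norm_nonneg _).trans (hM t))

theorem IsBC.sub {f g : ℝ → ℂ} (hf : IsBC f) (hg : IsBC g) : IsBC fun t => f t - g t := by
  simpa [sub_eq_add_neg] using hf.add ((IsBC.const (-1)).mul hg)

theorem IsBC.sum {ι : Type*} {s : Finset ι} {f : ι → ℝ → ℂ} (h : ∀ i ∈ s, IsBC (f i)) :
    IsBC fun t => ∑ i ∈ s, f i t := by
  classical
  induction s using Finset.induction_on with
  | empty => simpa using IsBC.const 0
  | insert i s hi ih =>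
    simp_rw [Finset.sum_insert hi]
    exact (h i (Finset.mem_insert_self i s)).add
      (ih fun j hj => h j (Finset.mem_insert_of_mem hj))

theorem IsBC.norm {f : ℝ → ℂ} (hf : IsBC f) : IsBC fun t => (‖f t‖ : ℂ) :=
  ⟨Complex.continuous_ofReal.comp hf.1.norm, hf.2.imp fun M hM t => by simpa using hM t⟩

theorem IsBC.comp_add {f : ℝ → ℂ} (hf : IsBC f) (b : ℝ) : IsBC fun t => f (t + b) :=
  ⟨hf.1.comp (by fun_prop), hf.2.imp fun M hM t => hM _⟩

theorem IsBC.comp_neg {f : ℝ → ℂ} (hf : IsBC f) : IsBC fun t => f (-t) :=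
  ⟨hf.1.comp (by fun_prop), hf.2.imp fun M hM t => hM _⟩

theorem greenKernel_of_neg {ω : ℂ} (hω : ω.re < 0) (t s : ℝ) :
    greenKernel ω t s
      = (Set.Iio t).indicator (fun s => Complex.exp (ω * ((t - s : ℝ) : ℂ))) s := by
  simp [greenKernel, Real.sign_of_neg hω, Set.indicator_apply]

/-- Time reversal reduces `Re ω > 0` to `Re ω < 0`, where the kernel lives on `s < t`. -/
theorem greenKernel_neg (ω : ℂ) (t s : ℝ) :
    greenKernel (-ω) (-t) (-s) = -greenKernel ω t s := by
  have e : -Real.sign ω.re * (-t - -s) = Real.sign ω.re * (t - s) := by ring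
  have e' : -ω * ((-t - -s : ℝ) : ℂ) = ω * ((t - s : ℝ) : ℂ) := by push_cast; ring
  unfold greenKernel
  rw [Complex.neg_re, Real.sign_neg, e, e']
  split_ifs <;> simp

theorem greenKernel_add (ω : ℂ) (t s b : ℝ) :
    greenKernel ω (t + b) (s + b) = greenKernel ω t s := by
  simp [greenKernel]

/-- This lets `I_{α_j}`, which appears in `L_0` and `Q_0`, control `G_{γ_j}`. -/
theorem norm_greenKernel_re (ω : ℂ) (t s : ℝ) :
    ‖greenKernel (ω.re : ℂ) t s‖ = ‖greenKernel ω t s‖ := by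
  unfold greenKernel
  rw [Complex.ofReal_re]
  split_ifs
  · simp [Complex.norm_exp]
  · rfl

theorem norm_greenKernel_of_neg {ω : ℂ} (hω : ω.re < 0) (t s : ℝ) :
    ‖greenKernel ω t s‖
      = (Set.Iio t).indicator (fun s => Real.exp (ω.re * t) * Real.exp (-ω.re * s)) s := by
  rw [greenKernel_of_neg hω, norm_indicator_eq_indicator_norm]
  congr 1
  ext s
  rw [Complex.norm_exp, ← Real.exp_add]
  congr 1
  simp
  ring

theorem integrable_norm_greenKernel_of_neg {ω : ℂ} (hω : ω.re < 0) (t : ℝ) :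
    Integrable (fun s => ‖greenKernel ω t s‖) ∧ ∫ s, ‖greenKernel ω t s‖ = 1 / |ω.re| := by
  have h := (integrableOn_exp_mul_Iic (a := -ω.re) (by linarith) t).const_mul
    (Real.exp (ω.re * t))
  simp_rw [norm_greenKernel_of_neg hω]
  rw [integral_indicator measurableSet_Iio, ← integral_Iic_eq_integral_Iio,
    integral_const_mul, integral_exp_mul_Iic (by linarith)]
  refine ⟨(IntegrableOn.mono_set h Set.Iio_subset_Iic_self).integrable_indicator measurableSet_Iio, ?_⟩
  rw [abs_of_neg hω, mul_div_assoc', ← Real.exp_add]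
  simp

theorem integrable_norm_greenKernel {ω : ℂ} (hω : ω.re ≠ 0) (t : ℝ) :
    Integrable (fun s => ‖greenKernel ω t s‖) ∧ ∫ s, ‖greenKernel ω t s‖ = 1 / |ω.re| := by
  rcases hω.lt_or_gt with h | h
  · exact integrable_norm_greenKernel_of_neg h t
  · have h1 := integrable_norm_greenKernel_of_neg (ω := -ω) (by simpa using h) (-t)
    have e (s : ℝ) : ‖greenKernel ω t s‖ = ‖greenKernel (-ω) (-t) (-s)‖ := by
      rw [greenKernel_neg, norm_neg]
    simp_rw [e]
    rw [integral_neg_eq_self (fun s => ‖greenKernel (-ω) (-t) s‖), h1.2, Complex.neg_re, abs_neg]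
    exact ⟨h1.1.comp_neg, rfl⟩

theorem measurable_greenKernel (ω : ℂ) (t : ℝ) : Measurable (greenKernel ω t) := by
  unfold greenKernel
  refine Measurable.ite (measurableSet_lt (by fun_prop) measurable_const) ?_ measurable_const
  fun_prop

theorem integrable_greenKernel_mul {ω : ℂ} (hω : ω.re ≠ 0) {f : ℝ → ℂ} (hf : IsBC f) (t : ℝ) :
    Integrable fun s => greenKernel ω t s * f s := by
  obtain ⟨hc, M, hM⟩ := hf
  refine Integrable.mul_bdd ?_ hc.aestronglyMeasurable (Filter.Eventually.of_forall hM)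
  exact (integrable_norm_iff (measurable_greenKernel ω t).aestronglyMeasurable).1
    (integrable_norm_greenKernel hω t).1

theorem opI_nonneg (ω : ℂ) (f : ℝ → ℂ) (t : ℝ) : 0 ≤ opI ω f t :=
  integral_nonneg fun _ => norm_nonneg _

theorem opI_le {ω : ℂ} (hω : ω.re ≠ 0) {f : ℝ → ℂ} {M : ℝ} (hM : ∀ t, ‖f t‖ ≤ M) (t : ℝ) :
    opI ω f t ≤ M / |ω.re| := by
  have h := integrable_norm_greenKernel hω t
  calc opI ω f t ≤ ∫ s, ‖greenKernel ω t s‖ * M := by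
        refine integral_mono_of_nonneg (Filter.Eventually.of_forall fun _ => norm_nonneg _)
          (h.1.mul_const M) (Filter.Eventually.of_forall fun s => ?_)
        simp only [norm_mul]
        exact mul_le_mul_of_nonneg_left (hM s) (norm_nonneg _)
    _ = _ := by rw [integral_mul_const, h.2]; ring

theorem norm_opG_le_opI (ω : ℂ) (f : ℝ → ℂ) (t : ℝ) : ‖opG ω f t‖ ≤ opI ω f t :=
  norm_integral_le_integral_norm _

theorem opI_re (ω : ℂ) (f : ℝ → ℂ) (t : ℝ) : opI (ω.re : ℂ) f t = opI ω f t := by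
  simp only [opI, norm_mul, norm_greenKernel_re]

theorem opG_add_right (ω : ℂ) (f : ℝ → ℂ) (t b : ℝ) :
    opG ω f (t + b) = opG ω (fun s => f (s + b)) t := by
  unfold opG
  rw [← integral_add_right_eq_self _ b]
  simp_rw [greenKernel_add]

theorem opI_add_right (ω : ℂ) (f : ℝ → ℂ) (t b : ℝ) :
    opI ω f (t + b) = opI ω (fun s => f (s + b)) t := by
  unfold opI
  rw [← integral_add_right_eq_self _ b]
  simp_rw [greenKernel_add]

theorem opG_sub {ω : ℂ} (hω : ω.re ≠ 0) {f g : ℝ → ℂ} (hf : IsBC f) (hg : IsBC g) (t : ℝ) :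
    opG ω (fun s => f s - g s) t = opG ω f t - opG ω g t := by
  unfold opG
  simp_rw [mul_sub]
  exact integral_sub (integrable_greenKernel_mul hω hf t) (integrable_greenKernel_mul hω hg t)

/-- Boundedness of `f` makes the supremum a genuine one; an unbounded `⨆` in `ℝ` would have the
value `0`. -/
theorem opI_le_supNorm {ω : ℂ} (hω : ω.re ≠ 0) {f : ℝ → ℂ} (hf : IsBC f) (t : ℝ) :
    opI ω f t ≤ supNorm (opI ω f) := by
  obtain ⟨_, M, hM⟩ := hf
  refine (le_abs_self _).trans (le_ciSup (f := fun t => |opI ω f t|) ⟨M / |ω.re|, ?_⟩ t)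
  rintro _ ⟨s, rfl⟩
  simpa [abs_of_nonneg (opI_nonneg ω f s)] using opI_le hω hM s

theorem supNorm_nonneg (u : ℝ → ℝ) : 0 ≤ supNorm u := Real.iSup_nonneg fun _ => abs_nonneg _

theorem hasDerivAt_integral_Iic {h : ℝ → ℂ} (hc : Continuous h)
    (hi : ∀ t, IntegrableOn h (Set.Iic t)) (t : ℝ) :
    HasDerivAt (fun x => ∫ s in Set.Iic x, h s) (h t) t := by
  have e : (fun x => ∫ s in Set.Iic x, h s)
      = fun x => (∫ s in (0 : ℝ)..x, h s) + ∫ s in Set.Iic 0, h s := by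
    ext x
    rw [← intervalIntegral.integral_Iic_sub_Iic (hi 0) (hi x)]
    ring
  rw [e]
  exact (intervalIntegral.integral_hasDerivAt_right (hc.intervalIntegrable _ _)
    (hc.stronglyMeasurableAtFilter _ _) hc.continuousAt).add_const _

/-- Variation of constants: `G_ω[f](t) = e^{ωt} ∫_{-∞}^t e^{-ωs} f(s) ds`, and the product rule
applies. -/
theorem hasDerivAt_opG_of_neg {ω : ℂ} (hω : ω.re < 0) {f : ℝ → ℂ} (hf : IsBC f) (t : ℝ) :
    HasDerivAt (opG ω f) (ω * opG ω f t + f t) t := by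
  have hexp : Continuous fun s : ℝ => Complex.exp (-ω * s) := by fun_prop
  have hi (x : ℝ) : IntegrableOn (fun s : ℝ => Complex.exp (-ω * s) * f s) (Set.Iic x) := by
    obtain ⟨hc, M, hM⟩ := hf
    exact Integrable.mul_bdd (integrableOn_exp_mul_complex_Iic (by simpa using hω) x)
      hc.aestronglyMeasurable (Filter.Eventually.of_forall hM)
  have e : opG ω f = fun t : ℝ => Complex.exp (ω * t) *
      ∫ s in Set.Iic t, Complex.exp (-ω * s) * f s := by
    ext x
    have e1 (s : ℝ) : greenKernel ω x s * f s = (Set.Iio x).indicator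
        (fun s : ℝ => Complex.exp (ω * x) * (Complex.exp (-ω * s) * f s)) s := by
      rw [greenKernel_of_neg hω, Set.indicator_apply, Set.indicator_apply]
      split_ifs
      · rw [← mul_assoc, ← Complex.exp_add]
        congr 2
        push_cast
        ring
      · simp
    unfold opG
    simp_rw [e1]
    rw [integral_indicator measurableSet_Iio, ← integral_Iic_eq_integral_Iio, integral_const_mul]
  have h1 : HasDerivAt (fun t : ℝ => Complex.exp (ω * t)) (Complex.exp (ω * t) * ω) t := by
    simpa using ((Complex.ofRealCLM.hasDerivAt (x := t)).const_mul ω).cexp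
  have h2 := h1.mul (hasDerivAt_integral_Iic (hexp.mul hf.1) hi t)
  rw [e]
  refine h2.congr_deriv ?_
  simp only [Pi.mul_apply]
  have h3 : Complex.exp (ω * t) * Complex.exp (-ω * t) = 1 := by
    rw [← Complex.exp_add]; simp
  linear_combination f t * h3

theorem opG_neg (ω : ℂ) (f : ℝ → ℂ) (t : ℝ) :
    opG ω f t = -opG (-ω) (fun s => f (-s)) (-t) := by
  unfold opG
  rw [← integral_neg_eq_self, ← integral_neg]
  refine integral_congr_ae (Filter.Eventually.of_forall fun s => ?_)
  have := greenKernel_neg ω t (-s)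
  rw [neg_neg] at this
  simp [this]

theorem hasDerivAt_opG {ω : ℂ} (hω : ω.re ≠ 0) {f : ℝ → ℂ} (hf : IsBC f) (t : ℝ) :
    HasDerivAt (opG ω f) (ω * opG ω f t + f t) t := by
  rcases hω.lt_or_gt with h | h
  · exact hasDerivAt_opG_of_neg h hf t
  · have h1 := hasDerivAt_opG_of_neg (ω := -ω) (by simpa using h) hf.comp_neg (-t)
    have h2 := (h1.scomp t (hasDerivAt_neg t)).neg
    have e : opG ω f = fun t => -opG (-ω) (fun s => f (-s)) (-t) := funext (opG_neg ω f)
    rw [e]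
    refine h2.congr_deriv ?_
    simp
    ring

theorem IsBC.opG {ω : ℂ} (hω : ω.re ≠ 0) {f : ℝ → ℂ} (hf : IsBC f) : IsBC (opG ω f) :=
  ⟨continuous_iff_continuousAt.2 fun t => (hasDerivAt_opG hω hf t).continuousAt,
    hf.2.imp' (· / |ω.re|) fun _ hM t => (norm_opG_le_opI ω f t).trans (opI_le hω hM t)⟩

end

end PoincarePerron

namespace PoincarePerron

noncomputable section

open MeasureTheory Filter

/-! Functions whose translates are controlled by the translates of a given family. -/

/-- `F` is subordinate to the family `r` if two translates of `F` are uniformly close as soon as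
the corresponding translates of all members of `r` are. -/
def IsSubord {ι : Type*} (r : ι → ℝ → ℂ) (F : ℝ → ℂ) : Prop :=
  ∀ ε > 0, ∃ δ > 0, ∀ b c : ℝ, (∀ i t, ‖r i (t + b) - r i (t + c)‖ ≤ δ) →
    ∀ t, ‖F (t + b) - F (t + c)‖ ≤ ε

section Subord

variable {ι : Type*} {r : ι → ℝ → ℂ}

theorem IsSubord.const (c : ℂ) : IsSubord r fun _ => c :=
  fun ε hε => ⟨1, one_pos, fun _ _ _ _ => by simpa using hε.le⟩

theorem isSubord_self (i : ι) : IsSubord r (r i) :=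
  fun ε hε => ⟨ε, hε, fun _ _ h t => h i t⟩

theorem IsSubord.add {f g : ℝ → ℂ} (hf : IsSubord r f) (hg : IsSubord r g) :
    IsSubord r fun t => f t + g t := by
  intro ε hε
  obtain ⟨δ, hδ, h⟩ := hf (ε / 2) (by positivity)
  obtain ⟨δ', hδ', h'⟩ := hg (ε / 2) (by positivity)
  refine ⟨min δ δ', lt_min hδ hδ', fun b c hbc t => ?_⟩
  have h1 := h b c (fun i t => (hbc i t).trans (min_le_left _ _)) t
  have h2 := h' b c (fun i t => (hbc i t).trans (min_le_right _ _)) t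
  rw [add_sub_add_comm]
  exact (norm_add_le _ _).trans (by linarith)

theorem IsSubord.mul {f g : ℝ → ℂ} (hf : IsSubord r f) (hg : IsSubord r g) (bf : IsBC f)
    (bg : IsBC g) : IsSubord r fun t => f t * g t := by
  intro ε hε
  obtain ⟨M, hM⟩ := bf.2
  obtain ⟨M', hM'⟩ := bg.2
  have hM0 : 0 ≤ M := (norm_nonneg _).trans (hM 0)
  have hM0' : 0 ≤ M' := (norm_nonneg _).trans (hM' 0)
  obtain ⟨δ, hδ, h⟩ := hf (ε / (M + M' + 1)) (by positivity)
  obtain ⟨δ', hδ', h'⟩ := hg (ε / (M + M' + 1)) (by positivity)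
  refine ⟨min δ δ', lt_min hδ hδ', fun b c hbc t => ?_⟩
  have h1 := h b c (fun i t => (hbc i t).trans (min_le_left _ _)) t
  have h2 := h' b c (fun i t => (hbc i t).trans (min_le_right _ _)) t
  have e : f (t + b) * g (t + b) - f (t + c) * g (t + c)
      = (f (t + b) - f (t + c)) * g (t + b) + f (t + c) * (g (t + b) - g (t + c)) := by ring
  rw [e]
  calc _ ≤ ε / (M + M' + 1) * M' + M * (ε / (M + M' + 1)) := by
        refine (norm_add_le _ _).trans ?_
        rw [norm_mul, norm_mul]
        exact add_le_add (mul_le_mul h1 (hM' _) (norm_nonneg _) (by positivity))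
          (mul_le_mul (hM _) h2 (norm_nonneg _) hM0)
    _ = ε * ((M + M') / (M + M' + 1)) := by ring
    _ ≤ ε * 1 := by
        gcongr
        rw [div_le_one (by positivity)]
        linarith
    _ = ε := mul_one ε

/-- `G_ω` commutes with translations and has sup-norm bound `1 / |Re ω|`, whence the tolerance `ε *
|Re ω|`. -/
theorem IsSubord.opG {ω : ℂ} (hω : ω.re ≠ 0) {f : ℝ → ℂ} (hf : IsSubord r f) (bf : IsBC f) :
    IsSubord r (opG ω f) := by
  intro ε hε
  have hp := abs_pos.2 hω
  obtain ⟨δ, hδ, h⟩ := hf (ε * |ω.re|) (by positivity)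
  refine ⟨δ, hδ, fun b c hbc t => ?_⟩
  rw [opG_add_right, opG_add_right, ← opG_sub hω (bf.comp_add b) (bf.comp_add c)]
  refine (norm_opG_le_opI _ _ _).trans ((opI_le hω (h b c hbc) t).trans (le_of_eq ?_))
  field_simp

/-- Uniform limits of subordinate functions are subordinate. -/
theorem IsSubord.of_approx {f : ℝ → ℂ}
    (h : ∀ ε > 0, ∃ g, IsSubord r g ∧ ∀ t, ‖f t - g t‖ ≤ ε) : IsSubord r f := by
  intro ε hε
  obtain ⟨g, hg, hfg⟩ := h (ε / 3) (by positivity)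
  obtain ⟨δ, hδ, h⟩ := hg (ε / 3) (by positivity)
  refine ⟨δ, hδ, fun b c hbc t => ?_⟩
  have h1 := h b c hbc t
  have h2 := hfg (t + b)
  have h3 := hfg (t + c)
  rw [norm_sub_rev] at h3
  have e : f (t + b) - f (t + c) = (f (t + b) - g (t + b)) + (g (t + b) - g (t + c))
    + (g (t + c) - f (t + c)) := by ring
  rw [e]
  exact (norm_add₃_le).trans (by linarith)

/-- The bounded continuous functions as a subalgebra. -/
def bcAlg : Subalgebra ℂ (ℝ → ℂ) where
  carrier := {f | IsBC f}
  mul_mem' hf hg := hf.mul hg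
  add_mem' hf hg := hf.add hg
  algebraMap_mem' c := IsBC.const c

/-- The bounded continuous functions subordinate to a family as a subalgebra. -/
def subordAlg (r : ι → ℝ → ℂ) : Subalgebra ℂ (ℝ → ℂ) where
  carrier := {f | IsBC f ∧ IsSubord r f}
  mul_mem' hf hg := ⟨hf.1.mul hg.1, hf.2.mul hg.2 hf.1 hg.1⟩
  add_mem' hf hg := ⟨hf.1.add hg.1, hf.2.add hg.2⟩
  algebraMap_mem' c := ⟨IsBC.const c, IsSubord.const c⟩

end Subord

/-! ### Almost periodicity: boundedness, inheritance by subordinate functions, lower bounds for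
averages. -/

theorem IsAP.isBC {f : ℝ → ℂ} (hf : IsAP f) : IsBC f := by
  refine ⟨hf.1, ?_⟩
  by_contra! h
  choose b hb using fun k : ℕ => h k
  obtain ⟨φ, hφ, g, hg⟩ := hf.2 b
  have h1 := (hg.tendsto_at 0).norm
  simp only [zero_add] at h1
  refine not_tendsto_nhds_of_tendsto_atTop ?_ _ h1
  refine tendsto_atTop_mono (fun m => (hb (φ m)).le) ?_
  exact tendsto_natCast_atTop_atTop.comp hφ.tendsto_atTop

theorem exists_common_subseq {ι : Type*} {r : ι → ℝ → ℂ} (hr : ∀ i, IsAP (r i)) (s : Finset ι)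
    (b : ℕ → ℝ) : ∃ φ : ℕ → ℕ, StrictMono φ ∧ ∀ i ∈ s, ∃ g : ℝ → ℂ,
      TendstoUniformly (fun (m : ℕ) (t : ℝ) => r i (t + b (φ m))) g atTop := by
  classical
  induction s using Finset.induction_on with
  | empty => exact ⟨id, strictMono_id, by simp⟩
  | insert i s hi ih =>
    obtain ⟨φ, hφ, h⟩ := ih
    obtain ⟨ψ, hψ, g, hg⟩ := (hr i).2 (b ∘ φ)
    refine ⟨φ ∘ ψ, hφ.comp hψ, fun j hj => ?_⟩
    rcases Finset.mem_insert.1 hj with rfl | hj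
    · exact ⟨g, hg⟩
    · obtain ⟨g', hg'⟩ := h j hj
      refine ⟨g', ?_⟩
      rw [tendstoUniformly_iff_tendstoUniformlyOnFilter] at hg' ⊢
      exact fun u hu => (hψ.tendsto_atTop.prodMap tendsto_id).eventually (hg' u hu)

/-- Finiteness of the family gives one subsequence along which all translates of the `r i` converge;
subordination makes those of `F` uniformly Cauchy. -/
theorem IsSubord.isAP {ι : Type*} [Fintype ι] {r : ι → ℝ → ℂ} (hr : ∀ i, IsAP (r i)) {F : ℝ → ℂ}
    (hF : IsSubord r F) (hc : Continuous F) : IsAP F := by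
  refine ⟨hc, fun b => ?_⟩
  obtain ⟨φ, hφ, h⟩ := exists_common_subseq hr Finset.univ b
  refine ⟨φ, hφ, ?_⟩
  choose g hg using fun i => h i (Finset.mem_univ i)
  have hcau : UniformCauchySeqOn (fun (m : ℕ) (t : ℝ) => F (t + b (φ m))) atTop Set.univ := by
    rw [Metric.uniformCauchySeqOn_iff]
    intro ε hε
    obtain ⟨δ, hδ, hF'⟩ := hF (ε / 2) (by positivity)
    have h1 : ∀ᶠ m in atTop, ∀ i, ∀ t, dist (g i t) (r i (t + b (φ m))) < δ / 2 :=
      eventually_all.2 fun i => Metric.tendstoUniformly_iff.1 (hg i) (δ / 2) (by positivity)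
    obtain ⟨N, hN⟩ := eventually_atTop.1 h1
    refine ⟨N, fun m hm k hk t _ => ?_⟩
    rw [dist_eq_norm]
    refine (hF' (b (φ m)) (b (φ k)) (fun i t => ?_) t).trans_lt (by linarith)
    rw [← dist_eq_norm]
    have h2 := hN m hm i t
    have h3 := hN k hk i t
    rw [dist_comm] at h2
    exact (dist_triangle _ (g i t) _).trans (by linarith)
  choose G hG using fun t => cauchySeq_tendsto_of_complete (hcau.cauchySeq (Set.mem_univ t))
  refine ⟨G, ?_⟩
  rw [← tendstoUniformlyOn_univ]
  exact hcau.tendstoUniformlyOn_of_tendsto fun t _ => hG t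

/-- For an almost periodic function that does not vanish identically, its averages against an
exponential weight are bounded away from zero. -/
theorem IsAP.exists_pos_le_opI {p : ℝ → ℂ} (hp : IsAP p) (h0 : ∃ t, p t ≠ 0) {β : ℝ}
    (hβ : 0 < β) : ∃ c > 0, ∀ t, c ≤ opI (β : ℂ) p t + opI ((-β : ℝ) : ℂ) p t := by
  -- Otherwise the averages tend to `0` along some `b k`. A uniform limit `q` of translates of `p`
  -- then has vanishing averages at `0`, so `q = 0`, and uniformity forces `p = 0`.
  by_contra! h
  choose b hb using fun k : ℕ => h (1 / ((k : ℝ) + 1)) (by positivity)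
  obtain ⟨φ, hφ, q, hq⟩ := hp.2 b
  obtain ⟨M, hM⟩ := hp.isBC.2
  have hqM (t : ℝ) : ‖q t‖ ≤ M :=
    le_of_tendsto (hq.tendsto_at t).norm (Eventually.of_forall fun m => hM _)
  have hqc : Continuous q := hq.continuous (Frequently.of_forall fun m => hp.1.comp (by fun_prop))
  have hsmall : Tendsto (fun m => 1 / ((φ m : ℝ) + 1)) atTop (nhds 0) :=
    tendsto_one_div_add_atTop_nhds_zero_nat.comp hφ.tendsto_atTop
  -- At `t = 0` each of the two kernels is nonzero exactly on one open half-line, so `q` vanishes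
  -- there by continuity.
  have key (ω : ℝ) (hω : ω = β ∨ ω = -β) : ∀ s : ℝ, s ≠ 0 → Real.sign ω * (0 - s) < 0 →
      q s = 0 := by
    have hω0 : (ω : ℂ).re ≠ 0 := by
      rcases hω with rfl | rfl <;> simp [hβ.ne']
    have hlim : Tendsto (fun m => opI (ω : ℂ) p (0 + b (φ m))) atTop (nhds 0) := by
      refine squeeze_zero (fun m => opI_nonneg _ _ _) (fun m => ?_) hsmall
      have := (hb (φ m)).le
      rw [zero_add]
      rcases hω with rfl | rfl
      · linarith [opI_nonneg ((-ω : ℝ) : ℂ) p (b (φ m))]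
      · linarith [opI_nonneg (β : ℂ) p (b (φ m))]
    have hlim' : Tendsto (fun m => opI (ω : ℂ) p (0 + b (φ m))) atTop (nhds (opI (ω : ℂ) q 0)) := by
      simp_rw [opI_add_right]
      refine tendsto_integral_of_dominated_convergence (fun s => ‖greenKernel ω 0 s‖ * M)
        (fun m => ?_) ((integrable_norm_greenKernel hω0 0).1.mul_const M) (fun m => ?_) ?_
      · exact ((measurable_greenKernel _ _).aestronglyMeasurable.mul
          (hp.1.comp (by fun_prop)).aestronglyMeasurable).norm
      · refine Eventually.of_forall fun s => ?_
        rw [norm_norm, norm_mul]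
        exact mul_le_mul_of_nonneg_left (hM _) (norm_nonneg _)
      · exact Eventually.of_forall fun s => ((hq.tendsto_at s).const_mul _).norm
    have hzero := tendsto_nhds_unique hlim' hlim
    have hint := (integrable_greenKernel_mul hω0 ⟨hqc, M, hqM⟩ 0).norm
    have hae := (integral_eq_zero_iff_of_nonneg (fun s => norm_nonneg _) hint).1 hzero
    intro s hs hs'
    by_contra hne
    have hopen : IsOpen {s : ℝ | Real.sign ω * (0 - s) < 0 ∧ q s ≠ 0} :=
      (isOpen_lt (f := fun s : ℝ => Real.sign ω * (0 - s)) (by fun_prop)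
        continuous_const).inter (isOpen_ne_fun hqc continuous_const)
    have hpos := hopen.measure_pos (μ := volume) ⟨s, hs', hne⟩
    refine hpos.ne' (measure_mono_null ?_ hae)
    rintro u ⟨hu, hqu⟩ hcontra
    have hzero : ‖greenKernel ω 0 u * q u‖ = 0 := hcontra
    rw [norm_eq_zero, mul_eq_zero, or_iff_left hqu, greenKernel, Complex.ofReal_re, if_pos hu,
      mul_eq_zero, or_iff_left (Complex.exp_ne_zero _), neg_eq_zero,
      Complex.ofReal_eq_zero] at hzero
    rw [hzero] at hu
    simp at hu
  have hq0 : ∀ s ∈ ({0}ᶜ : Set ℝ), q s = 0 := by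
    intro s hs
    rcases lt_or_gt_of_ne (show s ≠ 0 from hs) with h | h
    · exact key (-β) (Or.inr rfl) s hs (by rw [Real.sign_of_neg (by linarith)]; linarith)
    · exact key β (Or.inl rfl) s hs (by rw [Real.sign_of_pos hβ]; linarith)
  have hq00 : q = fun _ => 0 :=
    hqc.ext_on (dense_compl_singleton (0 : ℝ)) continuous_const hq0
  obtain ⟨t, ht⟩ := h0
  refine ht (norm_eq_zero.1 (le_antisymm (le_of_forall_pos_le_add fun ε hε => ?_)
    (norm_nonneg _)))
  obtain ⟨m, hm⟩ := (Metric.tendstoUniformly_iff.1 hq ε hε).exists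
  -- Uniformity is essential: the evaluation point moves with `m`, so that the translate of `p`
  -- there is `p t`.
  have := hm (t - b (φ m))
  rw [hq00] at this
  simp only [sub_add_cancel, dist_zero_left] at this
  linarith

end

end PoincarePerron

/-! ### The right-hand side as a function of the jet, and its Lipschitz estimate. -/

namespace PoincarePerron

noncomputable section

open MeasureTheory Filter BoundedContinuousFunction

theorem opI_le_sum {ι : Type*} {ω : ℂ} (hω : ω.re ≠ 0) {u : ℝ → ℂ} (S : Finset ι)
    {c : ι → ℝ} {f : ι → ℝ → ℂ} (hf : ∀ i ∈ S, IsBC (f i))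
    (h : ∀ s, ‖u s‖ ≤ ∑ i ∈ S, c i * ‖f i s‖) (t : ℝ) :
    opI ω u t ≤ ∑ i ∈ S, c i * opI ω (f i) t := by
  have hint : ∀ i ∈ S, Integrable fun s => c i * ‖greenKernel ω t s * f i s‖ :=
    fun i hi => (integrable_greenKernel_mul hω (hf i hi) t).norm.const_mul _
  calc opI ω u t ≤ ∫ s, ∑ i ∈ S, c i * ‖greenKernel ω t s * f i s‖ := by
        refine integral_mono_of_nonneg (Eventually.of_forall fun _ => norm_nonneg _)
          (integrable_finsetSum _ hint) (Eventually.of_forall fun s => ?_)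
        simp only [norm_mul]
        refine (mul_le_mul_of_nonneg_left (h s) (norm_nonneg _)).trans (le_of_eq ?_)
        rw [Finset.mul_sum]
        exact Finset.sum_congr rfl fun i _ => by ring
    _ = _ := by
        rw [integral_finsetSum _ hint]
        exact Finset.sum_congr rfl fun i _ => integral_const_mul _ _

/-- Passes from the grouping of `ℱ` by the order of `f_{i-1}` to the grouping by the coefficient
`a_i + r_i` used in `Q_β`. -/
theorem sum_Icc_sum_range_shift {M : Type*} [AddCommMonoid M] (n : ℕ) (g : ℕ → ℕ → M) :
    ∑ i ∈ Finset.Icc 2 n, ∑ j ∈ Finset.range (n - i + 1), g (i + j) j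
      = ∑ i ∈ Finset.Icc 2 n, ∑ k ∈ Finset.range (i - 1), g i k := by
  rw [Finset.sum_sigma', Finset.sum_sigma']
  refine Finset.sum_bij' (fun p _ => ⟨p.1 + p.2, p.2⟩) (fun p _ => ⟨p.1 - p.2, p.2⟩) ?_ ?_ ?_ ?_ ?_
  · rintro ⟨i, j⟩ h
    simp only [Finset.mem_sigma, Finset.mem_Icc, Finset.mem_range] at h ⊢
    omega
  · rintro ⟨i, j⟩ h
    simp only [Finset.mem_sigma, Finset.mem_Icc, Finset.mem_range] at h ⊢
    omega
  · rintro ⟨i, j⟩ h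
    simp
  · rintro ⟨i, j⟩ h
    simp only [Finset.mem_sigma, Finset.mem_Icc, Finset.mem_range] at h
    simp only [Sigma.mk.injEq, heq_eq_eq, and_true]
    omega
  · rintro ⟨i, j⟩ h
    rfl

section Equation

variable {n : ℕ}

/-- The linear term `ℒ` as a function of the jet `X = (z, z', …)`. -/
def linPart (r : Fin n → ℝ → ℂ) (lam : ℂ) (t : ℝ) (X : ℕ → ℂ) : ℂ :=
  ∑ k ∈ Finset.Icc 1 (n - 1), 1 / (k.factorial : ℂ) * derivPR r lam k t * X (k - 1)

/-- The nonlinear term `ℱ` as a function of the jet `X = (z, z', …)`. -/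
def nonlinPart (a : Fin n → ℂ) (r : Fin n → ℝ → ℂ) (lam : ℂ) (t : ℝ) (X : ℕ → ℂ) : ℂ :=
  ∑ i ∈ Finset.Icc 2 n, ∑ j ∈ Finset.range (n - i + 1),
    ((i + j).choose j : ℂ) * (coeffA a (i + j) + coeffR r (i + j) t) * lam ^ j *
      bellRem (i - 1) X

/-- The function `P(r; lam) + ℒ + ℱ` in terms of the jet `X = (z, z', …)`. -/
def rhsAt (a : Fin n → ℂ) (r : Fin n → ℝ → ℂ) (lam : ℂ) (t : ℝ) (X : ℕ → ℂ) : ℂ :=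
  evalPR r lam t + linPart r lam t X + nonlinPart a r lam t X

theorem rhs_eq_rhsAt (a : Fin n → ℂ) (r : Fin n → ℝ → ℂ) (lam : ℂ) (z : ℝ → ℂ) (t : ℝ) :
    rhs a r lam z t = rhsAt a r lam t (fun k => iteratedDeriv k z t) := rfl

theorem rhsAt_congr (a : Fin n → ℂ) (r : Fin n → ℝ → ℂ) (lam : ℂ) (t : ℝ) {X Y : ℕ → ℂ}
    (h : ∀ k < n - 1, X k = Y k) : rhsAt a r lam t X = rhsAt a r lam t Y := by
  unfold rhsAt linPart nonlinPart
  congr 1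
  · congr 1
    refine Finset.sum_congr rfl fun k hk => ?_
    rw [Finset.mem_Icc] at hk
    rw [h (k - 1) (by omega)]
  · refine Finset.sum_congr rfl fun i hi => Finset.sum_congr rfl fun j _ => ?_
    rw [Finset.mem_Icc] at hi
    rw [bellRem_congr (i - 1) fun k hk => h k (by omega)]

theorem rhsAt_zero (a : Fin n → ℂ) (r : Fin n → ℝ → ℂ) (lam : ℂ) (t : ℝ) :
    rhsAt a r lam t (fun _ => 0) = evalPR r lam t := by
  simp [rhsAt, linPart, nonlinPart, bellRem_zero]

theorem derivPR_eq_sum (r : Fin n → ℝ → ℂ) (lam : ℂ) (k : ℕ) (t : ℝ) :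
    derivPR r lam k t = ∑ i : Fin n,
      r i t * (Polynomial.derivative^[k] (Polynomial.X ^ (i : ℕ))).eval lam := by
  simp [derivPR, polyR, Polynomial.iterate_derivative_sum, Polynomial.iterate_derivative_C_mul,
    Polynomial.eval_finsetSum]

section Algebra

variable {r : Fin n → ℝ → ℂ} (S : Subalgebra ℂ (ℝ → ℂ))

theorem const_mem_subalgebra (c : ℂ) : (fun _ => c) ∈ S := S.algebraMap_mem c

theorem sum_fun_mem_subalgebra {ι : Type*} (s : Finset ι) {f : ι → ℝ → ℂ}
    (h : ∀ i ∈ s, f i ∈ S) : (fun t => ∑ i ∈ s, f i t) ∈ S := by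
  rw [← Finset.sum_fn]
  exact S.sum_mem h

/-- An arbitrary subalgebra is allowed so that one induction covers both `bcAlg` and `subordAlg`. -/
theorem bell_mem_subalgebra {X : ℝ → ℕ → ℂ} (hX : ∀ k, (fun t => X t k) ∈ S) (k : ℕ) :
    (fun t => bell (X t) k) ∈ S := by
  induction k using Nat.strong_induction_on with
  | _ k ih =>
    rcases k with _ | k
    · simpa [bell] using const_mem_subalgebra S 1
    · simp_rw [bell_succ]
      refine sum_fun_mem_subalgebra S _ fun j _ => ?_
      exact S.mul_mem (S.mul_mem (const_mem_subalgebra S _) (ih (k - j) (by omega))) (hX j)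

theorem bellRem_mem_subalgebra {X : ℝ → ℕ → ℂ} (hX : ∀ k, (fun t => X t k) ∈ S) (k : ℕ) :
    (fun t => bellRem k (X t)) ∈ S := by
  refine sum_fun_mem_subalgebra S _ fun j _ => ?_
  exact S.mul_mem (S.mul_mem (const_mem_subalgebra S _) (bell_mem_subalgebra S hX _)) (hX j)

variable {S}

theorem coeffR_mem_subalgebra (hr : ∀ i, r i ∈ S) (i : ℕ) : coeffR r i ∈ S := by
  have : coeffR r i = if h : i < n then r ⟨i, h⟩ else fun _ => 0 := by
    ext t
    unfold coeffR
    split_ifs <;> rfl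
  rw [this]
  split_ifs
  · exact hr _
  · exact const_mem_subalgebra S 0

theorem derivPR_mem_subalgebra (hr : ∀ i, r i ∈ S) (lam : ℂ) (k : ℕ) :
    derivPR r lam k ∈ S := by
  rw [funext (derivPR_eq_sum r lam k)]
  exact sum_fun_mem_subalgebra S _ fun i _ => S.mul_mem (hr i) (const_mem_subalgebra S _)

theorem evalPR_mem_subalgebra (hr : ∀ i, r i ∈ S) (lam : ℂ) : evalPR r lam ∈ S :=
  derivPR_mem_subalgebra hr lam 0

theorem linPart_mem_subalgebra (hr : ∀ i, r i ∈ S) (lam : ℂ) {X : ℝ → ℕ → ℂ}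
    (hX : ∀ k, (fun t => X t k) ∈ S) : (fun t => linPart r lam t (X t)) ∈ S :=
  sum_fun_mem_subalgebra S _ fun _ _ => S.mul_mem
    (S.mul_mem (const_mem_subalgebra S _) (derivPR_mem_subalgebra hr lam _)) (hX _)

theorem nonlinPart_mem_subalgebra (a : Fin n → ℂ) (hr : ∀ i, r i ∈ S) (lam : ℂ) {X : ℝ → ℕ → ℂ}
    (hX : ∀ k, (fun t => X t k) ∈ S) : (fun t => nonlinPart a r lam t (X t)) ∈ S :=
  sum_fun_mem_subalgebra S _ fun _ _ => sum_fun_mem_subalgebra S _ fun _ _ => S.mul_mem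
    (S.mul_mem (S.mul_mem (const_mem_subalgebra S _) (S.add_mem (const_mem_subalgebra S _)
      (coeffR_mem_subalgebra hr _))) (const_mem_subalgebra S _)) (bellRem_mem_subalgebra S hX _)

theorem rhsAt_mem_subalgebra (a : Fin n → ℂ) (hr : ∀ i, r i ∈ S) (lam : ℂ) {X : ℝ → ℕ → ℂ}
    (hX : ∀ k, (fun t => X t k) ∈ S) : (fun t => rhsAt a r lam t (X t)) ∈ S :=
  S.add_mem (S.add_mem (evalPR_mem_subalgebra hr lam) (linPart_mem_subalgebra hr lam hX))
    (nonlinPart_mem_subalgebra a hr lam hX)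

end Algebra

/-! The Green operator on jets. -/

/-- The `i`-th derivative of `G[f]`, for `i ≤ n - 2`. -/
def greenJet {N : ℕ} (γ : Fin N → ℂ) (i : ℕ) (f : ℝ → ℂ) (t : ℝ) : ℂ :=
  ∑ j, γ j ^ i / capGamma γ j * opG (γ j) f t

theorem norm_linPart_sub_le (r : Fin n → ℝ → ℂ) (lam : ℂ) (t : ℝ) {X Y : ℕ → ℂ} {D : ℝ}
    (hD : ∑ k ∈ Finset.range (n - 1), ‖X k - Y k‖ ≤ D) :
    ‖linPart r lam t X - linPart r lam t Y‖
      ≤ ∑ k ∈ Finset.Icc 1 (n - 1), 1 / (k.factorial : ℝ) * D * ‖derivPR r lam k t‖ := by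
  unfold linPart
  rw [← Finset.sum_sub_distrib]
  refine (norm_sum_le _ _).trans (Finset.sum_le_sum fun k hk => ?_)
  rw [Finset.mem_Icc] at hk
  have h1 : ‖X (k - 1) - Y (k - 1)‖ ≤ D :=
    (Finset.single_le_sum (f := fun k => ‖X k - Y k‖) (fun _ _ => norm_nonneg _)
      (Finset.mem_range.2 (by omega : k - 1 < n - 1))).trans hD
  rw [← mul_sub, norm_mul, norm_mul, norm_div, norm_one, Complex.norm_natCast, mul_right_comm]
  gcongr

theorem norm_nonlinPart_sub_le (a : Fin n → ℂ) (r : Fin n → ℝ → ℂ) (lam : ℂ) (t : ℝ) {δ : ℝ}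
    (hδ : 0 < δ) {X Y : ℕ → ℂ} {D : ℝ} (hX : ∑ k ∈ Finset.range (n - 1), ‖X k‖ ≤ δ)
    (hY : ∑ k ∈ Finset.range (n - 1), ‖Y k‖ ≤ δ)
    (hD : ∑ k ∈ Finset.range (n - 1), ‖X k - Y k‖ ≤ D) :
    ‖nonlinPart a r lam t X - nonlinPart a r lam t Y‖
      ≤ ∑ i ∈ Finset.Icc 2 n, (∑ k ∈ Finset.range (i - 1), (i.choose k : ℝ) * ‖lam‖ ^ k) *
        (lipMax n δ * D) * (‖coeffA a i‖ + ‖coeffR r i t‖) := by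
  have hre := sum_Icc_sum_range_shift n fun i k => (i.choose k : ℝ) * ‖lam‖ ^ k *
    (lipMax n δ * D) * (‖coeffA a i‖ + ‖coeffR r i t‖)
  simp_rw [Finset.sum_mul]
  rw [← hre]
  unfold nonlinPart
  rw [← Finset.sum_sub_distrib]
  refine (norm_sum_le _ _).trans (Finset.sum_le_sum fun i hi => ?_)
  rw [Finset.mem_Icc] at hi
  rw [← Finset.sum_sub_distrib]
  refine (norm_sum_le _ _).trans (Finset.sum_le_sum fun j _ => ?_)
  have h1 := norm_bellRem_sub_le_lipMax (n := n) (i := i - 2) (by omega) hδ hX hY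
  rw [show i - 2 + 1 = i - 1 by omega] at h1
  have h2 : ‖bellRem (i - 1) X - bellRem (i - 1) Y‖ ≤ lipMax n δ * D :=
    h1.trans (mul_le_mul_of_nonneg_left hD (lipMax_nonneg n δ))
  rw [← mul_sub, norm_mul, norm_mul, norm_mul, Complex.norm_natCast, norm_pow]
  calc _ ≤ ((i + j).choose j : ℝ) * (‖coeffA a (i + j)‖ + ‖coeffR r (i + j) t‖) * ‖lam‖ ^ j *
        (lipMax n δ * D) := by
        gcongr
        exact norm_add_le _ _
    _ = _ := by ring

theorem opI_add_le {ω : ℂ} (hω : ω.re ≠ 0) {f g : ℝ → ℂ} (hf : IsBC f) (hg : IsBC g) (t : ℝ) :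
    opI ω (fun s => f s + g s) t ≤ opI ω f t + opI ω g t := by
  have := opI_le_sum hω (u := fun s => f s + g s) (Finset.univ : Finset Bool)
    (c := fun _ => 1) (f := fun b => if b then f else g) (fun b _ => by cases b <;> simpa) 
    (fun s => by simpa using norm_add_le _ _) t
  simpa using this

/-- Lipschitz estimate for `G_{γ_j}` applied to the right-hand side. -/
theorem norm_opG_rhsAt_sub_le (a : Fin n → ℂ) {r : Fin n → ℝ → ℂ} (hr : ∀ i, IsBC (r i)) (lam : ℂ)
    {ω : ℂ} (hω : ω.re ≠ 0) {δ : ℝ} (hδ : 0 < δ) {X Y : ℝ → ℕ → ℂ} {D : ℝ} (hD0 : 0 ≤ D)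
    (hXc : ∀ k, IsBC fun t => X t k) (hYc : ∀ k, IsBC fun t => Y t k)
    (hX : ∀ t, ∑ k ∈ Finset.range (n - 1), ‖X t k‖ ≤ δ)
    (hY : ∀ t, ∑ k ∈ Finset.range (n - 1), ‖Y t k‖ ≤ δ)
    (hD : ∀ t, ∑ k ∈ Finset.range (n - 1), ‖X t k - Y t k‖ ≤ D) (t : ℝ) :
    ‖opG ω (fun s => rhsAt a r lam s (X s)) t - opG ω (fun s => rhsAt a r lam s (Y s)) t‖
      ≤ ∑ k ∈ Finset.Icc 1 (n - 1), 1 / (k.factorial : ℝ) * D * supNorm (opI ω (derivPR r lam k))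
        + ∑ i ∈ Finset.Icc 2 n, (∑ k ∈ Finset.range (i - 1), (i.choose k : ℝ) * ‖lam‖ ^ k) *
          (lipMax n δ * D) *
            (‖coeffA a i‖ / |ω.re| + supNorm (opI ω fun t => (‖coeffR r i t‖ : ℂ))) := by
  have hrS : ∀ i, r i ∈ bcAlg := hr
  have hXS : ∀ k, (fun t => X t k) ∈ bcAlg := hXc
  have hYS : ∀ k, (fun t => Y t k) ∈ bcAlg := hYc
  have hl : IsBC fun s => linPart r lam s (X s) - linPart r lam s (Y s) :=
    IsBC.sub (linPart_mem_subalgebra hrS lam hXS) (linPart_mem_subalgebra hrS lam hYS)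
  have hn : IsBC fun s => nonlinPart a r lam s (X s) - nonlinPart a r lam s (Y s) :=
    IsBC.sub (nonlinPart_mem_subalgebra a hrS lam hXS) (nonlinPart_mem_subalgebra a hrS lam hYS)
  rw [← opG_sub hω (rhsAt_mem_subalgebra a hrS lam hXS) (rhsAt_mem_subalgebra a hrS lam hYS)]
  have e : (fun s => rhsAt a r lam s (X s) - rhsAt a r lam s (Y s))
      = fun s => (linPart r lam s (X s) - linPart r lam s (Y s))
        + (nonlinPart a r lam s (X s) - nonlinPart a r lam s (Y s)) := by
    ext s
    unfold rhsAt
    ring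
  rw [e]
  refine (norm_opG_le_opI _ _ _).trans ((opI_add_le hω hl hn t).trans (add_le_add ?_ ?_))
  · refine (opI_le_sum hω (Finset.Icc 1 (n - 1)) (c := fun k => 1 / (k.factorial : ℝ) * D)
      (f := fun k => derivPR r lam k) (fun k _ => derivPR_mem_subalgebra hrS lam k)
      (fun s => norm_linPart_sub_le r lam s (hD s)) t).trans (Finset.sum_le_sum fun k _ => ?_)
    exact mul_le_mul_of_nonneg_left
      (opI_le_supNorm hω (derivPR_mem_subalgebra hrS lam k : IsBC _) t) (by positivity)
  · have hb (i : ℕ) : IsBC fun s => (‖coeffR r i s‖ : ℂ) :=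
      IsBC.norm (coeffR_mem_subalgebra hrS i)
    refine (opI_le_sum hω (Finset.Icc 2 n) (c := fun i =>
      (∑ k ∈ Finset.range (i - 1), (i.choose k : ℝ) * ‖lam‖ ^ k) * (lipMax n δ * D))
      (f := fun i s => (‖coeffA a i‖ : ℂ) + (‖coeffR r i s‖ : ℂ))
      (fun i _ => (IsBC.const _).add (hb i)) (fun s => ?_) t).trans
        (Finset.sum_le_sum fun i _ => ?_)
    · refine (norm_nonlinPart_sub_le a r lam s hδ (hX s) (hY s) (hD s)).trans (le_of_eq ?_)
      refine Finset.sum_congr rfl fun i _ => ?_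
      congr 1
      rw [← Complex.ofReal_add, Complex.norm_real, Real.norm_of_nonneg (by positivity)]
    · refine mul_le_mul_of_nonneg_left ?_ (mul_nonneg (by positivity)
        (mul_nonneg (lipMax_nonneg n δ) hD0))
      refine (opI_add_le hω (IsBC.const _) (hb i) t).trans
        (add_le_add (opI_le hω (fun _ => ?_) t) (opI_le_supNorm hω (hb i) t))
      simp

/-- The contraction estimate. The `i`-th jet component weights `G_{γ_j}` by `|γ_j|^i`; summing over
`i` produces `α̃_j`, and the scalar estimates assemble into `L_0` and `m(δ) Q_0`. -/
theorem sum_norm_greenJet_sub_le (a : Fin n → ℂ) {r : Fin n → ℝ → ℂ} (hr : ∀ i, IsBC (r i))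
    (lam : ℂ) {γ : Fin (n - 1) → ℂ} (hγ : ∀ j, (γ j).re ≠ 0) {δ : ℝ} (hδ : 0 < δ)
    {X Y : ℝ → ℕ → ℂ} {D : ℝ} (hD0 : 0 ≤ D)
    (hXc : ∀ k, IsBC fun t => X t k) (hYc : ∀ k, IsBC fun t => Y t k)
    (hX : ∀ t, ∑ k ∈ Finset.range (n - 1), ‖X t k‖ ≤ δ)
    (hY : ∀ t, ∑ k ∈ Finset.range (n - 1), ‖Y t k‖ ≤ δ)
    (hD : ∀ t, ∑ k ∈ Finset.range (n - 1), ‖X t k - Y t k‖ ≤ D) (t : ℝ) :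
    ∑ i ∈ Finset.range (n - 1), ‖greenJet γ i (fun s => rhsAt a r lam s (X s)) t
        - greenJet γ i (fun s => rhsAt a r lam s (Y s)) t‖
      ≤ (constL r lam γ 0 + lipMax n δ * constQ a r lam γ 0) * D := by
  set u : Fin (n - 1) → ℂ := fun j => opG (γ j) (fun s => rhsAt a r lam s (X s)) t
    - opG (γ j) (fun s => rhsAt a r lam s (Y s)) t with hu
  have h1 (i : ℕ) : ‖greenJet γ i (fun s => rhsAt a r lam s (X s)) t
      - greenJet γ i (fun s => rhsAt a r lam s (Y s)) t‖
      ≤ ∑ j, ‖γ j‖ ^ i * (‖u j‖ / ‖capGamma γ j‖) := by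
    unfold greenJet
    rw [← Finset.sum_sub_distrib]
    refine (norm_sum_le _ _).trans (Finset.sum_le_sum fun j _ => le_of_eq ?_)
    rw [← mul_sub, norm_mul, norm_div, norm_pow]
    ring
  refine (Finset.sum_le_sum fun i _ => h1 i).trans ?_
  rw [Finset.sum_comm]
  simp_rw [← Finset.sum_mul]
  have hsh (j : Fin (n - 1)) : shift γ 0 j = (γ j).re := by simp [shift]
  have hI (j : Fin (n - 1)) (f : ℝ → ℂ) : opI (shift γ 0 j : ℂ) f = opI (γ j) f := by
    rw [hsh]
    exact funext (opI_re (γ j) f)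
  unfold constL constQ
  simp_rw [hI, hsh]
  rw [Finset.mul_sum, ← Finset.sum_add_distrib, Finset.sum_mul]
  refine Finset.sum_le_sum fun j _ => ?_
  have hα : 0 ≤ alphaTilde γ j := Finset.sum_nonneg fun _ _ => by positivity
  have h2 := norm_opG_rhsAt_sub_le a hr lam (hγ j) hδ hD0 hXc hYc hX hY hD t
  have h3 := mul_le_mul_of_nonneg_left h2 (div_nonneg hα (norm_nonneg (capGamma γ j)))
  refine (le_of_eq ?_).trans (h3.trans (le_of_eq ?_))
  · rw [alphaTilde, hu]
    ring
  · rw [mul_add, add_mul, Finset.mul_sum, Finset.mul_sum, Finset.sum_mul, Finset.mul_sum,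
      Finset.sum_mul]
    congr 1
    · refine Finset.sum_congr rfl fun k _ => ?_
      rw [norm_div, norm_mul, Complex.norm_natCast, Complex.norm_real,
        Real.norm_of_nonneg hα]
      ring
    · refine Finset.sum_congr rfl fun i _ => ?_
      rw [Finset.mul_sum, Finset.sum_mul, Finset.sum_mul, Finset.sum_mul, Finset.mul_sum]
      exact Finset.sum_congr rfl fun k _ => by ring

end Equation

end

end PoincarePerron

/-! ### Derivatives of the Green operator and the fixed point. -/

namespace PoincarePerron

noncomputable section

open MeasureTheory Filter BoundedContinuousFunction

section GreenJet

variable {N : ℕ} {γ : Fin N → ℂ}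

theorem IsBC.greenJet (hγ : ∀ j, (γ j).re ≠ 0) {f : ℝ → ℂ} (hf : IsBC f) (i : ℕ) :
    IsBC (greenJet γ i f) :=
  IsBC.sum fun j _ => (IsBC.const _).mul (hf.opG (hγ j))

theorem greenJet_mem_subordAlg {ι : Type*} {r : ι → ℝ → ℂ} (hγ : ∀ j, (γ j).re ≠ 0) {f : ℝ → ℂ}
    (hf : f ∈ subordAlg r) (i : ℕ) : greenJet γ i f ∈ subordAlg r :=
  sum_fun_mem_subalgebra _ _ fun j _ => (subordAlg r).mul_mem (const_mem_subalgebra _ _)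
    ⟨hf.1.opG (hγ j), hf.2.opG (hγ j) hf.1⟩

theorem hasDerivAt_greenJet (hγ : ∀ j, (γ j).re ≠ 0) {f : ℝ → ℂ} (hf : IsBC f) (i : ℕ) (t : ℝ) :
    HasDerivAt (greenJet γ i f)
      (greenJet γ (i + 1) f t + (∑ j, γ j ^ i / capGamma γ j) * f t) t := by
  have h := HasDerivAt.fun_sum fun j (_ : j ∈ Finset.univ) =>
    (hasDerivAt_opG (hγ j) hf t).const_mul (γ j ^ i / capGamma γ j)
  refine h.congr_deriv ?_
  unfold greenJet
  rw [Finset.sum_mul, ← Finset.sum_add_distrib]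
  exact Finset.sum_congr rfl fun j _ => by ring

/-- The multiple of `f` created by differentiation has coefficient `∑ γ_j^i / Γ_j = 0` below the top
order. -/
theorem hasDerivAt_greenJet_of_lt (hinj : Function.Injective γ) (hγ : ∀ j, (γ j).re ≠ 0)
    {f : ℝ → ℂ} (hf : IsBC f) {i : ℕ} (hi : i + 1 < N) (t : ℝ) :
    HasDerivAt (greenJet γ i f) (greenJet γ (i + 1) f t) t := by
  have h := hasDerivAt_greenJet hγ hf i t
  rwa [sum_pow_div_capGamma γ hinj (by omega), if_neg (by omega), zero_mul, add_zero] at h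

theorem green_eq_greenJet (f : ℝ → ℂ) : green γ f = greenJet γ 0 f := by
  ext t
  simp [green, greenJet]

theorem iteratedDeriv_green (hinj : Function.Injective γ) (hγ : ∀ j, (γ j).re ≠ 0)
    {f : ℝ → ℂ} (hf : IsBC f) {i : ℕ} (hi : i < N) :
    iteratedDeriv i (green γ f) = greenJet γ i f := by
  induction i with
  | zero => rw [iteratedDeriv_zero, green_eq_greenJet]
  | succ i ih =>
    rw [iteratedDeriv_succ, ih (by omega)]
    exact funext fun t => (hasDerivAt_greenJet_of_lt hinj hγ hf hi t).deriv

end GreenJet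

section Equation

variable {n : ℕ}

theorem sum_norm_greenJet_le_constH {r : Fin n → ℝ → ℂ} {lam : ℂ} {γ : Fin (n - 1) → ℂ}
    (hinj : Function.Injective γ) (hγ : ∀ j, (γ j).re ≠ 0) (hp : IsBC (evalPR r lam)) (t : ℝ) :
    ∑ i ∈ Finset.range (n - 1), ‖greenJet γ i (evalPR r lam) t‖ ≤ constH r lam γ := by
  have e : (fun t => ∑ i ∈ Finset.range (n - 1), ‖iteratedDeriv i (green γ (evalPR r lam)) t‖)
      = fun t => ∑ i ∈ Finset.range (n - 1), ‖greenJet γ i (evalPR r lam) t‖ := by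
    ext t
    refine Finset.sum_congr rfl fun i hi => ?_
    rw [iteratedDeriv_green hinj hγ hp (Finset.mem_range.1 hi)]
  rw [constH, e]
  choose M hM using fun i => (hp.greenJet hγ i).2
  refine (le_abs_self _).trans (le_ciSup (f := fun t =>
    |∑ i ∈ Finset.range (n - 1), ‖greenJet γ i (evalPR r lam) t‖|)
    ⟨∑ i ∈ Finset.range (n - 1), M i, ?_⟩ t)
  rintro _ ⟨s, rfl⟩
  dsimp only
  rw [abs_of_nonneg (Finset.sum_nonneg fun _ _ => norm_nonneg _)]
  exact Finset.sum_le_sum fun i _ => hM i s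

theorem sum_norm_extend {N : ℕ} (x : PiLp 1 fun _ : Fin N => ℂ) :
    ∑ k ∈ Finset.range N, ‖extend x.ofLp k‖ = ‖x‖ := by
  rw [PiLp.norm_eq_of_L1, ← Fin.sum_univ_eq_sum_range (fun k => ‖extend x.ofLp k‖)]
  exact Finset.sum_congr rfl fun i _ => by rw [extend_apply _ i.2]

/-- The jet of the almost periodic solution of the Riccati type equation, obtained from the
contraction principle. -/
theorem exists_jet (a : Fin n → ℂ) {r : Fin n → ℝ → ℂ} (hr : ∀ i, IsAP (r i))
    (lam : ℂ) {γ : Fin (n - 1) → ℂ} (hinj : Function.Injective γ) (hγ : ∀ j, (γ j).re ≠ 0)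
    {δ : ℝ} (hδ : 0 < δ) (hκ0 : 0 ≤ constL r lam γ 0 + lipMax n δ * constQ a r lam γ 0)
    (hκ : constL r lam γ 0 + lipMax n δ * constQ a r lam γ 0 < 1)
    (hH : constH r lam γ ≤ (1 - (constL r lam γ 0 + lipMax n δ * constQ a r lam γ 0)) * δ) :
    ∃ X : ℝ → ℕ → ℂ, (∀ k, (fun t => X t k) ∈ subordAlg r) ∧
      (∀ k < n - 1, ∀ t, X t k = -greenJet γ k (fun s => rhsAt a r lam s (X s)) t) ∧
      ((∀ t, evalPR r lam t = 0) → ∀ t k, X t k = 0) := by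
  set κ := constL r lam γ 0 + lipMax n δ * constQ a r lam γ 0 with hκdef
  have hb : ∀ i, IsBC (r i) := fun i => (hr i).isBC
  have hbS : ∀ i, r i ∈ bcAlg := hb
  have hrS : ∀ i, r i ∈ subordAlg r := fun i => ⟨hb i, isSubord_self i⟩
  have hext (Z : ℝ →ᵇ PiLp 1 fun _ : Fin (n - 1) => ℂ) (k : ℕ) :
      IsBC fun t => extend (Z t).ofLp k := by
    refine ⟨(continuous_extend k).comp ((PiLp.continuous_ofLp 1 _).comp Z.continuous), ‖Z‖,
      fun t => (norm_extend_le _ k).trans (le_trans (le_of_eq ?_) (Z.norm_coe_le_norm t))⟩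
    rw [PiLp.norm_eq_of_L1, norm1]
  have hrhs (Z : ℝ →ᵇ PiLp 1 fun _ : Fin (n - 1) => ℂ) :
      IsBC fun s => rhsAt a r lam s (extend (Z s).ofLp) :=
    rhsAt_mem_subalgebra a hbS lam (S := bcAlg) (X := fun s => extend (Z s).ofLp) (hext Z)
  have hT (Z : ℝ →ᵇ PiLp 1 fun _ : Fin (n - 1) => ℂ) :
      ∃ W : ℝ →ᵇ PiLp 1 fun _ : Fin (n - 1) => ℂ, ∀ t (i : Fin (n - 1)),
        W t i = -greenJet γ i (fun s => rhsAt a r lam s (extend (Z s).ofLp)) t := by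
    have hg (i : ℕ) := (hrhs Z).greenJet hγ i
    choose M hM using fun i => (hg i).2
    refine ⟨BoundedContinuousFunction.ofNormedAddCommGroup
      (fun t => WithLp.toLp 1 fun i : Fin (n - 1) =>
        -greenJet γ i (fun s => rhsAt a r lam s (extend (Z s).ofLp)) t)
      ((PiLp.continuous_toLp 1 _).comp (continuous_pi fun i => (hg i).1.neg))
      (∑ i : Fin (n - 1), M i) (fun t => ?_), fun t i => rfl⟩
    rw [PiLp.norm_eq_of_L1]
    exact Finset.sum_le_sum fun i _ => by simpa using hM i t
  choose T hT using hT
  have hlip (Z W : ℝ →ᵇ PiLp 1 fun _ : Fin (n - 1) => ℂ) (hZ : ∀ t, ‖Z t‖ ≤ δ)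
      (hW : ∀ t, ‖W t‖ ≤ δ) : dist (T Z) (T W) ≤ κ * dist Z W := by
    rw [BoundedContinuousFunction.dist_le (mul_nonneg hκ0 dist_nonneg)]
    intro t
    have h := sum_norm_greenJet_sub_le a hb lam hγ hδ (X := fun s => extend (Z s).ofLp)
      (Y := fun s => extend (W s).ofLp) (D := dist Z W) dist_nonneg (hext Z) (hext W)
      (fun t => (sum_norm_extend _).trans_le (hZ t)) (fun t => (sum_norm_extend _).trans_le (hW t))
      (fun t => ?_) t
    · rw [dist_eq_norm, PiLp.norm_eq_of_L1]
      refine le_trans (le_of_eq ?_) h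
      rw [← Fin.sum_univ_eq_sum_range (fun i =>
        ‖greenJet γ i (fun s => rhsAt a r lam s (extend (Z s).ofLp)) t
          - greenJet γ i (fun s => rhsAt a r lam s (extend (W s).ofLp)) t‖)]
      refine Finset.sum_congr rfl fun i _ => ?_
      rw [PiLp.sub_apply, hT, hT, neg_sub_neg, norm_sub_rev]
    · simp_rw [extend_sub]
      refine le_trans (le_of_eq (sum_norm_extend (Z t - W t))) ?_
      rw [← dist_eq_norm]
      exact BoundedContinuousFunction.dist_coe_le_dist t
  have hzero (t : ℝ) (i : Fin (n - 1)) : T 0 t i = -greenJet γ i (evalPR r lam) t := by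
    rw [hT]
    congr 2
    ext s
    rw [← rhsAt_zero a r lam s]
    exact rhsAt_congr a r lam s fun k hk => by rw [extend_apply _ hk]; rfl
  have hT0 (t : ℝ) : ‖T 0 t‖ ≤ constH r lam γ := by
    refine le_trans (le_of_eq ?_)
      (sum_norm_greenJet_le_constH hinj hγ (evalPR_mem_subalgebra hbS lam) t)
    rw [PiLp.norm_eq_of_L1, ← Fin.sum_univ_eq_sum_range
      (fun i => ‖greenJet γ i (evalPR r lam) t‖)]
    exact Finset.sum_congr rfl fun i _ => by rw [hzero, norm_neg]
  -- Building subordination into the closed set makes it hold for the fixed point.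
  set S : Set (ℝ →ᵇ PiLp 1 fun _ : Fin (n - 1) => ℂ) :=
    {Z | (∀ t, ‖Z t‖ ≤ δ) ∧ ∀ k, IsSubord r fun t => extend (Z t).ofLp k} with hS
  have hSc : IsComplete S := by
    refine IsClosed.isComplete (isClosed_of_closure_subset fun Z hZ => ?_)
    rw [Metric.mem_closure_iff] at hZ
    have happ (ε : ℝ) (hε : 0 < ε) : ∃ W ∈ S, ∀ t, ‖Z t - W t‖ ≤ ε := by
      obtain ⟨W, hW, hd⟩ := hZ ε hε
      refine ⟨W, hW, fun t => ?_⟩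
      rw [← dist_eq_norm]
      exact (BoundedContinuousFunction.dist_coe_le_dist t).trans hd.le
    refine ⟨fun t => le_of_forall_pos_le_add fun ε hε => ?_, fun k => .of_approx fun ε hε => ?_⟩
    · obtain ⟨W, hW, hd⟩ := happ ε hε
      have := norm_add_le (W t) (Z t - W t)
      rw [add_sub_cancel] at this
      linarith [hW.1 t, hd t]
    · obtain ⟨W, hW, hd⟩ := happ ε hε
      refine ⟨_, hW.2 k, fun t => ?_⟩
      rw [extend_sub]
      refine (norm_extend_le _ k).trans (le_trans (le_of_eq ?_) (hd t))
      rw [PiLp.norm_eq_of_L1, norm1]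
      rfl
  have h0S : (0 : ℝ →ᵇ PiLp 1 fun _ : Fin (n - 1) => ℂ) ∈ S := by
    refine ⟨fun t => by simpa using hδ.le, fun k => ?_⟩
    have : (fun t : ℝ => extend ((0 : ℝ →ᵇ PiLp 1 fun _ : Fin (n - 1) => ℂ) t).ofLp k)
        = fun _ => 0 := by
      ext t
      simp [extend]
    rw [this]
    exact IsSubord.const 0
  have hmaps : Set.MapsTo T S S := by
    intro Z hZ
    refine ⟨fun t => ?_, fun k => ?_⟩
    · have h1 := hlip Z 0 hZ.1 h0S.1
      have h2 := (BoundedContinuousFunction.dist_coe_le_dist (f := T Z) (g := T 0) t).trans h1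
      have h3 : dist Z 0 ≤ δ := (BoundedContinuousFunction.dist_le hδ.le).2 fun t => by
        simpa using hZ.1 t
      have h4 := mul_le_mul_of_nonneg_left h3 hκ0
      rw [dist_eq_norm] at h2
      have h5 := norm_add_le (T Z t - T 0 t) (T 0 t)
      rw [sub_add_cancel] at h5
      linarith [hT0 t]
    · by_cases hk : k < n - 1
      · have e : (fun t => extend (T Z t).ofLp k)
            = fun t => -greenJet γ k (fun s => rhsAt a r lam s (extend (Z s).ofLp)) t := by
          ext t
          rw [extend_apply _ hk]
          exact hT Z t ⟨k, hk⟩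
        rw [e]
        exact ((subordAlg r).neg_mem (greenJet_mem_subordAlg hγ
          (rhsAt_mem_subalgebra a hrS lam (X := fun s => extend (Z s).ofLp)
            fun k => ⟨hext Z k, hZ.2 k⟩) k)).2
      · have e : (fun t => extend (T Z t).ofLp k) = fun _ => 0 := by
          ext t
          simp [extend, hk]
        rw [e]
        exact IsSubord.const 0
  have hcontr : ContractingWith ⟨κ, hκ0⟩ (hmaps.restrict T S S) := by
    refine ⟨by exact_mod_cast hκ, LipschitzWith.of_dist_le_mul fun Z W => ?_⟩
    exact hlip Z W Z.2.1 W.2.1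
  obtain ⟨Z, hZS, hZ, -⟩ := hcontr.exists_fixedPoint' hSc hmaps h0S (edist_ne_top _ _)
  have hZ' : T Z = Z := hZ
  refine ⟨fun t => extend (Z t).ofLp, fun k => ⟨hext Z k, hZS.2 k⟩, fun k hk t => ?_,
    fun hp t k => ?_⟩
  · rw [← hT Z t ⟨k, hk⟩, hZ']
    exact extend_apply _ hk
  -- If `P(r; λ) = 0`, then `0` is also fixed, and `dist Z 0 ≤ κ * dist Z 0` with `κ < 1` gives `Z =
  -- 0`.
  · have h0 : T 0 = 0 := by
      ext t i
      rw [hzero]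
      simp [greenJet, opG, hp]
    have h1 := hlip Z 0 hZS.1 h0S.1
    rw [h0, hZ'] at h1
    have h2 : dist Z 0 = 0 := by
      have := dist_nonneg (x := Z) (y := 0)
      nlinarith
    rw [dist_eq_zero] at h2
    rw [h2]
    simp [extend]

end Equation

end

end PoincarePerron

namespace PoincarePerron

noncomputable section

open MeasureTheory Filter

/-! Taylor coefficients of the polynomials `P(a; x)` and `P(r; x)`. -/

theorem eval_iterate_derivative_div_factorial (s : Finset ℕ) (c : ℕ → ℂ) (lam : ℂ) (j : ℕ) :
    1 / (j.factorial : ℂ) * (Polynomial.derivative^[j]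
      (∑ i ∈ s, Polynomial.C (c i) * Polynomial.X ^ i)).eval lam
      = ∑ i ∈ s, c i * ((i.choose j : ℂ) * lam ^ (i - j)) := by
  rw [Polynomial.iterate_derivative_sum, Polynomial.eval_finsetSum, Finset.mul_sum]
  refine Finset.sum_congr rfl fun i _ => ?_
  rw [Polynomial.iterate_derivative_C_mul, Polynomial.iterate_derivative_X_pow_eq_C_mul,
    Nat.descFactorial_eq_factorial_mul_choose]
  have : (j.factorial : ℂ) ≠ 0 := by exact_mod_cast j.factorial_ne_zero
  simp only [Polynomial.eval_mul, Polynomial.eval_C, Polynomial.eval_pow, Polynomial.eval_X,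
    Nat.cast_mul]
  field_simp

section Equation

variable {n : ℕ}

theorem polyA_eq_sum (a : Fin n → ℂ) :
    polyA a = ∑ i ∈ Finset.range (n + 1),
      Polynomial.C (coeffA a i) * Polynomial.X ^ i := by
  rw [Finset.sum_range_succ, ← Fin.sum_univ_eq_sum_range
    (fun i => Polynomial.C (coeffA a i) * (Polynomial.X ^ i : Polynomial ℂ)), polyA, add_comm]
  simp [coeffA]

theorem polyR_eq_sum (r : Fin n → ℝ → ℂ) (t : ℝ) :
    polyR r t = ∑ i ∈ Finset.range (n + 1),
      Polynomial.C (coeffR r i t) * Polynomial.X ^ i := by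
  rw [Finset.sum_range_succ, ← Fin.sum_univ_eq_sum_range
    (fun i => Polynomial.C (coeffR r i t) * (Polynomial.X ^ i : Polynomial ℂ)), polyR]
  simp [coeffR]

theorem coeffD_eq_sum (a : Fin n → ℂ) (lam : ℂ) (j : ℕ) :
    coeffD a lam j
      = ∑ i ∈ Finset.range (n + 1), coeffA a i * ((i.choose j : ℂ) * lam ^ (i - j)) := by
  rw [coeffD, polyA_eq_sum, eval_iterate_derivative_div_factorial]

theorem coeffD_self (a : Fin n → ℂ) (lam : ℂ) : coeffD a lam n = 1 := by
  rw [coeffD_eq_sum, Finset.sum_range_succ, Finset.sum_eq_zero]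
  · simp [coeffA]
  · intro i hi
    rw [Nat.choose_eq_zero_of_lt (Finset.mem_range.1 hi)]
    simp

theorem derivPR_div_factorial_eq_sum (r : Fin n → ℝ → ℂ) (lam : ℂ) (k : ℕ) (t : ℝ) :
    1 / (k.factorial : ℂ) * derivPR r lam k t
      = ∑ i ∈ Finset.range (n + 1), coeffR r i t * ((i.choose k : ℂ) * lam ^ (i - k)) := by
  rw [derivPR, polyR_eq_sum, eval_iterate_derivative_div_factorial]

theorem derivPR_div_factorial_self (r : Fin n → ℝ → ℂ) (lam : ℂ) (t : ℝ) :
    1 / (n.factorial : ℂ) * derivPR r lam n t = 0 := by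
  rw [derivPR_div_factorial_eq_sum, Finset.sum_range_succ, Finset.sum_eq_zero]
  · simp [coeffR]
  · intro i hi
    rw [Nat.choose_eq_zero_of_lt (Finset.mem_range.1 hi)]
    simp

theorem eval_polyD (a : Fin n → ℂ) (lam x : ℂ) :
    (polyD a lam).eval x = ∑ j ∈ Finset.Icc 1 n, coeffD a lam j * x ^ (j - 1) := by
  simp [polyD, Polynomial.eval_finsetSum]

/-- The quotient `y^(i) / y` in terms of the jet `X` of `z = y' / y - lam`. -/
def quot (lam : ℂ) (i : ℕ) (X : ℕ → ℂ) : ℂ :=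
  ∑ m ∈ Finset.range (i + 1), (i.choose m : ℂ) * lam ^ (i - m) * bell X m

theorem quot_congr (lam : ℂ) (i : ℕ) {X Y : ℕ → ℂ} (h : ∀ k < i, X k = Y k) :
    quot lam i X = quot lam i Y := by
  refine Finset.sum_congr rfl fun m hm => ?_
  rw [Finset.mem_range] at hm
  rw [bell_congr m fun k hk => h k (by omega)]

theorem quot_zero (lam : ℂ) (i : ℕ) : quot lam i (fun _ => 0) = lam ^ i := by
  unfold quot
  rw [Finset.sum_range_succ', Finset.sum_eq_zero]
  · simp [bell]
  · intro m _
    simp [bell_succ]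

theorem quot_mem_subalgebra {S : Subalgebra ℂ (ℝ → ℂ)} (lam : ℂ) (i : ℕ) {X : ℝ → ℕ → ℂ}
    (hX : ∀ k, (fun t => X t k) ∈ S) : (fun t => quot lam i (X t)) ∈ S :=
  sum_fun_mem_subalgebra S _ fun _ _ => S.mul_mem (const_mem_subalgebra S _)
    (bell_mem_subalgebra S hX _)

/-- The algebraic identity relating the linear equation for `y` to the Riccati type equation
for `z = y' / y - lam`. -/
theorem sum_coeff_mul_quot (hn : 1 ≤ n) (a : Fin n → ℂ) (r : Fin n → ℝ → ℂ) {lam : ℂ}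
    (hlam : (polyA a).IsRoot lam) (t : ℝ) (X : ℕ → ℂ) :
    ∑ i ∈ Finset.range (n + 1), (coeffA a i + coeffR r i t) * quot lam i X
      = (∑ j ∈ Finset.Icc 1 n, coeffD a lam j * X (j - 1)) + rhsAt a r lam t X := by
  set c : ℕ → ℂ := fun i => coeffA a i + coeffR r i t with hc
  -- `d m` is the `m`-th Taylor coefficient at `lam` of the full polynomial `P(a; x) + P(r; x)`;
  -- exchanging sums gives `∑ d_m B_m`.
  set d : ℕ → ℂ := fun m => ∑ i ∈ Finset.range (n + 1),
    c i * ((i.choose m : ℂ) * lam ^ (i - m)) with hd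
  have hd' (m : ℕ) : d m = coeffD a lam m + 1 / (m.factorial : ℂ) * derivPR r lam m t := by
    rw [coeffD_eq_sum, derivPR_div_factorial_eq_sum, ← Finset.sum_add_distrib]
    exact Finset.sum_congr rfl fun i _ => by rw [hc]; ring
  have h1 : ∑ i ∈ Finset.range (n + 1), c i * quot lam i X
      = ∑ m ∈ Finset.range (n + 1), d m * bell X m := by
    have e (i) (hi : i ∈ Finset.range (n + 1)) : c i * quot lam i X
        = ∑ m ∈ Finset.range (n + 1), c i * ((i.choose m : ℂ) * lam ^ (i - m)) * bell X m := by
      rw [quot, Finset.mul_sum]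
      rw [Finset.mem_range] at hi
      rw [← Finset.sum_subset (Finset.range_subset_range.2 (by omega : i + 1 ≤ n + 1))]
      · exact Finset.sum_congr rfl fun m _ => by ring
      · intro m _ hm
        rw [Finset.mem_range] at hm
        rw [Nat.choose_eq_zero_of_lt (by omega)]
        simp
    rw [Finset.sum_congr rfl e, Finset.sum_comm]
    exact Finset.sum_congr rfl fun m _ => by rw [hd, Finset.sum_mul]
  have hd0 : d 0 = evalPR r lam t := by
    rw [hd' 0]
    have : coeffD a lam 0 = 0 := by
      have h : (polyA a).eval lam = 0 := hlam
      simp [coeffD, h]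
    rw [this]
    simp [derivPR, evalPR]
  have hIcc : ∑ m ∈ Finset.range (n + 1), d m * bell X m
      = d 0 + ∑ m ∈ Finset.Icc 1 n, d m * bell X m := by
    rw [Finset.range_eq_Ico, Finset.sum_eq_sum_Ico_succ_bot (by omega)]
    simp only [bell, mul_one, zero_add]
    rfl
  have hb (m) (hm : m ∈ Finset.Icc 1 n) :
      d m * bell X m = d m * X (m - 1) + d m * bellRem (m - 1) X := by
    rw [Finset.mem_Icc] at hm
    rw [bellRem_eq, show m - 1 + 1 = m by omega]
    ring
  have hlin : ∑ m ∈ Finset.Icc 1 n, d m * X (m - 1)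
      = (∑ j ∈ Finset.Icc 1 n, coeffD a lam j * X (j - 1)) + linPart r lam t X := by
    simp_rw [hd', add_mul]
    rw [Finset.sum_add_distrib, linPart]
    congr 1
    obtain ⟨N, rfl⟩ : ∃ N, n = N + 1 := ⟨n - 1, by omega⟩
    -- `P(r; x)` has degree below `n`, so `ℒ` stops at `n - 1`.
    rw [Finset.sum_Icc_succ_top (by omega), derivPR_div_factorial_self]
    simp
  have hnon : ∑ m ∈ Finset.Icc 1 n, d m * bellRem (m - 1) X = nonlinPart a r lam t X := by
    have e : ∑ m ∈ Finset.Icc 1 n, d m * bellRem (m - 1) X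
        = ∑ m ∈ Finset.Icc 2 n, d m * bellRem (m - 1) X := by
      refine (Finset.sum_subset (Finset.Icc_subset_Icc_left (by omega)) fun m hm hm' => ?_).symm
      rw [Finset.mem_Icc] at hm hm'
      have : m = 1 := by omega
      subst this
      simp [bellRem]
    rw [e, nonlinPart]
    refine Finset.sum_congr rfl fun m hm => ?_
    rw [Finset.mem_Icc] at hm
    rw [← Finset.sum_mul]
    congr 1
    rw [hd]
    dsimp only
    rw [← Finset.sum_range_add_sum_Ico _ (by omega : m ≤ n + 1), Finset.sum_eq_zero, zero_add,
      Finset.sum_Ico_eq_sum_range, show n + 1 - m = n - m + 1 by omega]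
    · refine Finset.sum_congr rfl fun j _ => ?_
      rw [Nat.add_sub_cancel_left, Nat.choose_symm_add]
      ring
    · intro i hi
      rw [Nat.choose_eq_zero_of_lt (Finset.mem_range.1 hi)]
      simp
  rw [h1, hIcc, Finset.sum_congr rfl hb, Finset.sum_add_distrib, hlin, hnon, hd0, rhsAt]
  ring

end Equation

/-! Derivatives of exponentials of primitives. -/

theorem iteratedDeriv_cexp_ofReal (lam : ℂ) (m : ℕ) :
    iteratedDeriv m (fun t : ℝ => Complex.exp (lam * t))
      = fun t : ℝ => lam ^ m * Complex.exp (lam * t) := by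
  induction m with
  | zero => simp
  | succ m ih =>
    rw [iteratedDeriv_succ, ih]
    ext t
    have h1 : HasDerivAt (fun t : ℝ => Complex.exp (lam * t)) (Complex.exp (lam * t) * lam) t := by
      simpa using ((Complex.ofRealCLM.hasDerivAt (x := t)).const_mul lam).cexp
    rw [(h1.const_mul _).deriv]
    ring

theorem contDiff_of_hasDerivAt_mul {N : ℕ} {z w : ℝ → ℂ} (hz : ContDiff ℝ N z)
    (hw : ∀ t, HasDerivAt w (z t * w t) t) {m : ℕ} (hm : m ≤ N + 1) : ContDiff ℝ m w := by
  have hd : deriv w = fun t => z t * w t := funext fun t => (hw t).deriv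
  induction m with
  | zero =>
    exact contDiff_zero.2 (continuous_iff_continuousAt.2 fun t => (hw t).continuousAt)
  | succ m ih =>
    rw [Nat.cast_succ, contDiff_succ_iff_deriv, hd]
    refine ⟨fun t => (hw t).differentiableAt, by simp, ?_⟩
    exact (hz.of_le (by exact_mod_cast (by omega : m ≤ N))).mul (ih (by omega))

/-- The derivatives of a solution of `w' = z w` are given by complete Bell polynomials. -/
theorem iteratedDeriv_eq_bell {N : ℕ} {z w : ℝ → ℂ} (hz : ContDiff ℝ N z)
    (hw : ∀ t, HasDerivAt w (z t * w t) t) {k : ℕ} (hk : k ≤ N + 1) (t : ℝ) :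
    iteratedDeriv k w t = bell (fun j => iteratedDeriv j z t) k * w t := by
  induction k using Nat.strong_induction_on with
  | _ k ih =>
    rcases k with _ | k
    · simp [bell]
    · have hd : deriv w = z * w := funext fun t => (hw t).deriv
      have hzk : ContDiff ℝ k z := hz.of_le (by exact_mod_cast (by omega : k ≤ N))
      have hwk : ContDiff ℝ k w := contDiff_of_hasDerivAt_mul hz hw (by omega)
      -- Leibniz' rule for `w' = z w` is exactly the Bell recursion.
      rw [iteratedDeriv_succ', hd, iteratedDeriv_mul hzk.contDiffAt hwk.contDiffAt, bell_succ,
        Finset.sum_mul]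
      refine Finset.sum_congr rfl fun j _ => ?_
      rw [ih (k - j) (by omega) (by omega)]
      ring

/-- The factor `w = e^{-λt} y` satisfies `w' = z w`; Leibniz' rule for `e^{λt} w` supplies the
binomial sum. -/
theorem iteratedDeriv_eq_quot_mul {N : ℕ} {z y : ℝ → ℂ} {lam : ℂ} (hz : ContDiff ℝ N z)
    (hy : ∀ t, HasDerivAt y ((lam + z t) * y t) t) {i : ℕ} (hi : i ≤ N + 1) (t : ℝ) :
    iteratedDeriv i y t = quot lam i (fun j => iteratedDeriv j z t) * y t := by
  have hexp (c : ℂ) (t : ℝ) :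
      HasDerivAt (fun t : ℝ => Complex.exp (c * t)) (Complex.exp (c * t) * c) t := by
    simpa using ((Complex.ofRealCLM.hasDerivAt (x := t)).const_mul c).cexp
  have hinv (t : ℝ) : Complex.exp (lam * t) * Complex.exp (-lam * t) = 1 := by
    rw [← Complex.exp_add]; simp
  set w : ℝ → ℂ := fun t => Complex.exp (-lam * t) * y t with hwdef
  have hw (t : ℝ) : HasDerivAt w (z t * w t) t := by
    refine ((hexp (-lam) t).mul (hy t)).congr_deriv ?_
    rw [hwdef]
    ring
  have hyw : y = (fun t : ℝ => Complex.exp (lam * t)) * w := by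
    ext t
    rw [Pi.mul_apply, hwdef, ← mul_assoc, hinv, one_mul]
  have hec : ContDiff ℝ i fun t : ℝ => Complex.exp (lam * t) :=
    (contDiff_const.mul Complex.ofRealCLM.contDiff).cexp
  have hwc : ContDiff ℝ i w := contDiff_of_hasDerivAt_mul hz hw hi
  have hwt : y t = Complex.exp (lam * t) * w t := congrFun hyw t
  rw [hwt]
  conv_lhs => rw [hyw]
  rw [mul_comm, iteratedDeriv_mul hwc.contDiffAt hec.contDiffAt, quot, Finset.sum_mul]
  refine Finset.sum_congr rfl fun m hm => ?_
  rw [Finset.mem_range] at hm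
  rw [iteratedDeriv_eq_bell hz hw (by omega), iteratedDeriv_cexp_ofReal]
  ring

end

end PoincarePerron

/-! ### From the fixed point to the differential equations, the explicit solution and the `O`
estimates. -/

namespace PoincarePerron

noncomputable section

open MeasureTheory Filter Asymptotics

section Equation

variable {n : ℕ}

/-- Derivatives of a function whose jet solves the integral equation. -/
theorem iteratedDeriv_of_jet (hn : 2 ≤ n) {γ : Fin (n - 1) → ℂ} (hinj : Function.Injective γ)
    (hγ : ∀ j, (γ j).re ≠ 0) {f : ℝ → ℂ} (hf : IsBC f) {X : ℝ → ℕ → ℂ}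
    (hX : ∀ k < n - 1, ∀ t, X t k = -greenJet γ k f t) :
    (∀ k < n - 1, iteratedDeriv k (fun t => X t 0) = fun t => X t k) ∧
      (iteratedDeriv (n - 1) fun t => X t 0) = (fun t => -(greenJet γ (n - 1) f t + f t)) ∧
      ContDiff ℝ (n - 1 : ℕ) fun t => X t 0 := by
  have h1 : ∀ k < n - 1, iteratedDeriv k (fun t => X t 0) = fun t => X t k := by
    intro k hk
    have e : (fun t => X t 0) = fun t => -green γ f t :=
      funext fun t => by rw [hX 0 (by omega), green_eq_greenJet]
    ext t
    rw [e, iteratedDeriv_fun_neg, iteratedDeriv_green hinj hγ hf hk, hX k hk]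
  have h2 (k : ℕ) (hk : k < n - 1) : (fun t => X t k) = fun t => -greenJet γ k f t :=
    funext (hX k hk)
  have h3 : (iteratedDeriv (n - 1) fun t => X t 0)
      = fun t => -(greenJet γ (n - 1) f t + f t) := by
    obtain ⟨N, hN⟩ : ∃ N, n - 1 = N + 1 := ⟨n - 2, by omega⟩
    ext t
    rw [show iteratedDeriv (n - 1) (fun t => X t 0) = iteratedDeriv (N + 1) fun t => X t 0 by
      rw [hN], iteratedDeriv_succ, h1 N (by omega), h2 N (by omega)]
    have h := (hasDerivAt_greenJet hγ hf N t).neg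
    -- At order `N = n - 2` the power sum is `1`, so the next derivative contains `f`.
    rw [sum_pow_div_capGamma γ hinj (by omega), if_pos (by omega), one_mul, ← hN] at h
    exact h.deriv
  refine ⟨h1, h3, ?_⟩
  rw [contDiff_nat_iff_iteratedDeriv]
  refine ⟨fun m hm => ?_, fun m hm => ?_⟩
  · rcases hm.eq_or_lt with rfl | hm
    · rw [h3]
      exact ((hf.greenJet hγ _).add hf).1.neg
    · rw [h1 m hm, h2 m hm]
      exact (hf.greenJet hγ _).1.neg
  · rw [h1 m hm, h2 m hm]
    exact fun t => (hasDerivAt_greenJet hγ hf m t).neg.differentiableAt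

/-- The Green operator inverts `𝒟`. -/
theorem opD_of_jet (hn : 2 ≤ n) (a : Fin n → ℂ) (lam : ℂ) {γ : Fin (n - 1) → ℂ}
    (hroot : ∀ j, (polyD a lam).IsRoot (γ j)) {f z : ℝ → ℂ}
    (hz : ∀ k < n - 1, ∀ t, iteratedDeriv k z t = -greenJet γ k f t)
    (hz' : ∀ t, iteratedDeriv (n - 1) z t = -(greenJet γ (n - 1) f t + f t)) (t : ℝ) :
    opD a lam z t = -f t := by
  have h1 : opD a lam z t
      = ∑ j ∈ Finset.Icc 1 n, (-(coeffD a lam j * greenJet γ (j - 1) f t)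
        + if j = n then -f t else 0) := by
    refine Finset.sum_congr rfl fun j hj => ?_
    rw [Finset.mem_Icc] at hj
    rcases eq_or_ne j n with rfl | hne
    · rw [hz', coeffD_self, if_pos rfl]
      ring
    · rw [hz (j - 1) (by omega), if_neg hne]
      ring
  -- Each `G_{γ_l}[f]` is multiplied by the characteristic polynomial at its root `γ_l`; only `-f`
  -- from the monic top term survives.
  have h2 : ∑ j ∈ Finset.Icc 1 n, coeffD a lam j * greenJet γ (j - 1) f t = 0 := by
    simp_rw [greenJet, Finset.mul_sum]
    rw [Finset.sum_comm]
    refine Finset.sum_eq_zero fun l _ => ?_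
    have h := eval_polyD a lam (γ l)
    rw [show (polyD a lam).eval (γ l) = 0 from hroot l] at h
    have e (j : ℕ) : coeffD a lam j * (γ l ^ (j - 1) / capGamma γ l * opG (γ l) f t)
        = coeffD a lam j * γ l ^ (j - 1) * (opG (γ l) f t / capGamma γ l) := by ring
    simp_rw [e]
    rw [← Finset.sum_mul, ← h, zero_mul]
  rw [h1, Finset.sum_add_distrib, Finset.sum_neg_distrib, h2, neg_zero, zero_add,
    Finset.sum_ite_eq' (Finset.Icc 1 n) n, if_pos (Finset.mem_Icc.2 ⟨by omega, le_rfl⟩)]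

/-- The explicit formula for `y` in terms of the right-hand side `f`. -/
def solOf (n : ℕ) (lam : ℂ) (γ : Fin (n - 1) → ℂ) (f : ℝ → ℂ) (t : ℝ) : ℂ :=
  Complex.exp (lam * t) *
    Complex.exp ((-1) ^ n * (∏ j, (γ j)⁻¹) * ∫ s in (0 : ℝ)..t, f s) *
    Complex.exp (-∑ j, 1 / (capGamma γ j * γ j) * opG (γ j) f t)

theorem solOf_ne_zero (lam : ℂ) (γ : Fin (n - 1) → ℂ) (f : ℝ → ℂ) (t : ℝ) :
    solOf n lam γ f t ≠ 0 :=
  mul_ne_zero (mul_ne_zero (Complex.exp_ne_zero _) (Complex.exp_ne_zero _)) (Complex.exp_ne_zero _)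

/-- Since `G_{γ_j}[f]' = γ_j G_{γ_j}[f] + f`, the sum `∑ G_{γ_j}[f] / (Γ_j γ_j)` has derivative
`G[f] + c f` with `c = ∑ 1 / (Γ_j γ_j)`. The integral factor cancels `c f`, leaving the logarithmic
derivative `λ - G[f]`. -/
theorem hasDerivAt_solOf (hn : 2 ≤ n) (lam : ℂ) {γ : Fin (n - 1) → ℂ}
    (hinj : Function.Injective γ) (hγ : ∀ j, (γ j).re ≠ 0) {f : ℝ → ℂ} (hf : IsBC f) (t : ℝ) :
    HasDerivAt (solOf n lam γ f) ((lam + -green γ f t) * solOf n lam γ f t) t := by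
  have hγ0 (j) : γ j ≠ 0 := fun h => hγ j (by simp [h])
  have h1 : HasDerivAt (fun t : ℝ => Complex.exp (lam * t)) (Complex.exp (lam * t) * lam) t := by
    simpa using ((Complex.ofRealCLM.hasDerivAt (x := t)).const_mul lam).cexp
  have h2 := ((intervalIntegral.integral_hasDerivAt_right (hf.1.intervalIntegrable 0 t)
    (hf.1.stronglyMeasurableAtFilter _ _) hf.1.continuousAt).const_mul
      ((-1) ^ n * ∏ j, (γ j)⁻¹)).cexp
  have h3 := (HasDerivAt.fun_sum fun j (_ : j ∈ Finset.univ) =>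
    (hasDerivAt_opG (hγ j) hf t).const_mul (1 / (capGamma γ j * γ j))).fun_neg.cexp
  have hsum := sum_one_div_capGamma_mul (by omega) γ hinj hγ0
  rw [show n - 1 + 1 = n by omega] at hsum
  have e : ∑ j, 1 / (capGamma γ j * γ j) * (γ j * opG (γ j) f t + f t)
      = green γ f t + ((-1) ^ n * ∏ j, (γ j)⁻¹) * f t := by
    rw [← hsum, green, Finset.sum_mul, ← Finset.sum_add_distrib]
    refine Finset.sum_congr rfl fun j _ => ?_
    have : 1 / (capGamma γ j * γ j) * γ j = 1 / capGamma γ j := by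
      rw [one_div, mul_inv, mul_assoc, inv_mul_cancel₀ (hγ0 j), mul_one, one_div]
    linear_combination opG (γ j) f t * this
  refine ((h1.fun_mul h2).fun_mul h3).congr_deriv ?_
  rw [e, solOf]
  ring

/-- The filter `⊤` makes the bound uniform in `t`. The gauge is either bounded away from `0` or,
when `P(r; lam) = 0`, irrelevant because `F = 0`. -/
theorem isBigO_gauge {r : Fin n → ℝ → ℂ} {lam : ℂ} (hp : IsAP (evalPR r lam)) {β : ℝ}
    (hβ : 0 < β) {F : ℝ → ℂ} (hF : IsBC F)
    (hF0 : (∀ t, evalPR r lam t = 0) → ∀ t, F t = 0) : F =O[⊤] gauge r lam β := by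
  rw [isBigO_top]
  by_cases h : ∃ t, evalPR r lam t ≠ 0
  · obtain ⟨c, hc, hle⟩ := hp.exists_pos_le_opI h hβ
    obtain ⟨M, hM⟩ := hF.2
    refine ⟨M / c, fun t => (hM t).trans ?_⟩
    have hM0 : 0 ≤ M := (norm_nonneg _).trans (hM t)
    have h1 : c ≤ ‖gauge r lam β t‖ := (hle t).trans (le_abs_self _)
    calc M = M / c * c := by field_simp
      _ ≤ _ := by gcongr
  · push Not at h
    exact ⟨0, fun t => by simp [hF0 h t]⟩

end Equation

end

end PoincarePerron

open PoincarePerron Asymptotics in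
theorem theorem3p2 (n : ℕ) (hn : 2 ≤ n) (a : Fin n → ℂ) (r : Fin n → ℝ → ℂ)
    (hr : ∀ i, IsAP (r i))
    (lam : ℂ) (hlam : (polyA a).IsRoot lam)
    (γ : Fin (n - 1) → ℂ) (hγ_inj : Function.Injective γ)
    (hγ_root : ∀ j, (polyD a lam).IsRoot (γ j))
    (hγ_re : ∀ j, (γ j).re ≠ 0)
    (hL : constL r lam γ 0 < 1)
    (δl : ℝ) (hδl : 0 < δl)
    (hδl_lt : ∀ δ ∈ Set.Ioo 0 δl, 0 < lipMax n δ ∧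
      lipMax n δ < (1 - constL r lam γ 0) / constQ a r lam γ 0)
    (hδl_eq : lipMax n δl = (1 - constL r lam γ 0) / constQ a r lam γ 0)
    (hH : constH r lam γ ≤
      sSup ((fun δ => (1 - constL r lam γ 0 - lipMax n δ * constQ a r lam γ 0) * δ) ''
        Set.Ioo 0 δl)) :
    ∃ y z : ℝ → ℂ,
      IsSolution a r y ∧
      (∀ t : ℝ, y t =
        Complex.exp (lam * t) *
        Complex.exp ((-1) ^ n * (∏ j, (γ j)⁻¹) * ∫ s in (0 : ℝ)..t, rhs a r lam z s) *
        Complex.exp (-∑ j, 1 / (capGamma γ j * γ j) * opG (γ j) (rhs a r lam z) t)) ∧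
      (∀ t, z t = deriv y t / y t - lam) ∧
      IsAPUpTo (n - 2) z ∧
      ContDiff ℝ (n - 1 : ℕ) z ∧
      (∀ t, opD a lam z t + evalPR r lam t + termL r lam z t + termF a r lam z t = 0) ∧
      (∀ t, z t = -green γ (rhs a r lam z) t) ∧
      ∀ β : ℝ, 0 < β → (∀ j, β < |(γ j).re|) → constL r lam γ β < 1 / 2 →
        (∀ i ≤ n - 2, (iteratedDeriv i z) =O[⊤] (gauge r lam β)) ∧
        (∀ i ≤ n - 1, (fun t => iteratedDeriv i y t / y t - lam ^ i) =O[⊤] (gauge r lam β)) := by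
  have hL0 : 0 ≤ constL r lam γ 0 := Finset.sum_nonneg fun _ _ => Finset.sum_nonneg fun _ _ =>
    mul_nonneg (norm_nonneg _) (supNorm_nonneg _)
  have hα (j) : 0 ≤ alphaTilde γ j := Finset.sum_nonneg fun _ _ => by positivity
  have hQ0 : 0 ≤ constQ a r lam γ 0 := Finset.sum_nonneg fun j _ => Finset.sum_nonneg fun _ _ =>
    Finset.sum_nonneg fun _ _ => by
      have := hα j
      have := supNorm_nonneg
      refine mul_nonneg (by positivity) (add_nonneg (by positivity) (this _))
  obtain ⟨δ, hδ, hδ1, hδ2⟩ := exists_radius hn hQ0 hδl hδl_lt hδl_eq hH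
  obtain ⟨X, hXS, hX, hX0⟩ := exists_jet a hr lam hγ_inj hγ_re hδ
    (add_nonneg hL0 (mul_nonneg (lipMax_nonneg n δ) hQ0)) (by linarith)
    (hδ2.trans_eq (by ring))
  have hrS : ∀ i, r i ∈ subordAlg r := fun i => ⟨(hr i).isBC, isSubord_self i⟩
  have hp : IsAP (evalPR r lam) := by
    have h : evalPR r lam ∈ subordAlg r := evalPR_mem_subalgebra hrS lam
    exact h.2.isAP hr h.1.1
  set f : ℝ → ℂ := fun s => rhsAt a r lam s (X s) with hf
  have hfS : f ∈ subordAlg r := rhsAt_mem_subalgebra a hrS lam hXS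
  set z : ℝ → ℂ := fun t => X t 0 with hz
  obtain ⟨hzk, hzn, hzc⟩ := iteratedDeriv_of_jet hn hγ_inj hγ_re hfS.1 hX
  -- The fixed point equation makes the components `X t k`, `k ≤ n - 2`, the derivatives of `z`, and
  -- the right-hand side involves no others.
  have hrhs : rhs a r lam z = f := by
    ext t
    rw [rhs_eq_rhsAt]
    exact rhsAt_congr a r lam t fun k hk => congrFun (hzk k hk) t
  have hzG (t : ℝ) : z t = -green γ f t := by
    rw [green_eq_greenJet, hz]
    exact hX 0 (by omega) t
  have hopD (t : ℝ) : opD a lam z t = -f t :=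
    opD_of_jet hn a lam hγ_root (fun k hk t => (congrFun (hzk k hk) t).trans (hX k hk t))
      (fun t => congrFun hzn t) t
  set y : ℝ → ℂ := solOf n lam γ f with hy
  have hy0 (t : ℝ) : y t ≠ 0 := solOf_ne_zero lam γ f t
  have hyd (t : ℝ) : HasDerivAt y ((lam + z t) * y t) t := by
    rw [hzG]
    exact hasDerivAt_solOf hn lam hγ_inj hγ_re hfS.1 t
  have hyi (i : ℕ) (hi : i ≤ n) (t : ℝ) :
      iteratedDeriv i y t = quot lam i (fun j => iteratedDeriv j z t) * y t :=
    iteratedDeriv_eq_quot_mul hzc hyd (by omega) t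
  refine ⟨y, z, ⟨?_, fun t => ?_⟩, fun t => ?_, fun t => ?_, ⟨?_, fun i hi => ?_⟩, hzc, fun t => ?_,
    fun t => ?_, fun β hβ _ _ => ⟨fun i hi => ?_, fun i hi => ?_⟩⟩
  -- `y` gains one derivative over `z`: class `C^(n-1)` for `z` gives `C^n` for `y`.
  · exact contDiff_of_hasDerivAt_mul (N := n - 1) (z := fun t => lam + z t)
      (contDiff_const.add hzc) hyd (by omega)
  · have h := sum_coeff_mul_quot (by omega) a r hlam t fun j => iteratedDeriv j z t
    rw [← rhs_eq_rhsAt, hrhs, ← opD, hopD, neg_add_cancel, Finset.sum_range_succ,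
      ← Fin.sum_univ_eq_sum_range
        (fun i => (coeffA a i + coeffR r i t) * quot lam i fun j => iteratedDeriv j z t)] at h
    have hA : coeffA a n + coeffR r n t = 1 := by simp [coeffA, coeffR]
    rw [hA, one_mul] at h
    have e : ∑ i : Fin n, (a i + r i t) * iteratedDeriv i y t
        = (∑ i : Fin n, (coeffA a i + coeffR r i t) *
          quot lam i fun j => iteratedDeriv j z t) * y t := by
      rw [Finset.sum_mul]
      refine Finset.sum_congr rfl fun i _ => ?_
      rw [hyi i i.2.le]
      simp only [coeffA, coeffR, i.2, dif_pos]
      ring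
    rw [e, hyi n le_rfl]
    linear_combination y t * h
  · rw [hrhs, hy, solOf]
  · rw [(hyd t).deriv, mul_div_assoc, div_self (hy0 t)]
    ring
  · exact hzc.of_le (by exact_mod_cast (by omega : n - 2 ≤ n - 1))
  · rw [hzk i (by omega)]
    exact (hXS i).2.isAP hr (hXS i).1.1
  · have h := hopD t
    rw [← hrhs, rhs] at h
    linear_combination h
  · rw [hrhs]
    exact hzG t
  · refine isBigO_gauge hp hβ ?_ fun h0 t => ?_
    · rw [hzk i (by omega)]
      exact (hXS i).1
    · rw [hzk i (by omega)]
      exact hX0 h0 t i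
  -- For `i ≤ n - 1` the quotient is a polynomial in the jet alone, hence bounded, and equals `λ^i`
  -- at the zero jet.
  · have e (t : ℝ) : iteratedDeriv i y t / y t - lam ^ i = quot lam i (X t) - lam ^ i := by
      rw [hyi i (by omega), mul_div_assoc, div_self (hy0 t), mul_one]
      congr 1
      exact quot_congr lam i fun k hk => congrFun (hzk k (by omega)) t
    simp_rw [e]
    refine isBigO_gauge hp hβ ((subordAlg r).sub_mem (quot_mem_subalgebra lam i hXS)
      (const_mem_subalgebra _ _)).1 fun h0 t => ?_
    rw [show X t = fun _ => 0 from funext (hX0 h0 t), quot_zero, sub_self]
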